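/- **Braids.** $B_n$ is the Artin braid group with generators $\sigma_1,\dots,\sigma_{n-1}$ (trivial for $n\le 1$), and $|\_|:B_n\to S_n$ sends $\sigma_i$ to $(i,i+1)$; write $s(i)=|s|(i)$. In a product $st$ the braid $t$ comes first. For $s\in B_k$ and $j_1,\dots,j_k\ge 0$, $s[j_1,\dots,j_k]\in B_{j_1+\dots+j_k}$ is obtained from $s$ by replacing the $m$-th strand by $j_m$ parallel strands (deleting it if $j_m=0$); $t_1\oplus\dots\oplus t_k$ is the block direct sum. **Closed braided operads.** A (planar) operad $\mathcal P$ consists of sets $\mathcal P(n)$, $n\in\mathbf N$, an identity $\mathit{id}\in\mathcal P(1)$ and composites $g(f_1,\dots,f_n)\in\mathcal P(k_1+\dots+k_n)$ for $g\in\mathcal P(n)$, $f_i\in\mathcal P(k_i)$, satisfying the unit and associativity laws. It is *braided* if it is equipped with right actions $\mathcal P(n)\times B_n\to\mathcal P(n)$ such that $$(fs)(g_1,\dots,g_k)=\bigl(f(g_{s^{-1}(1)},\dots,g_{s^{-1}(k)})\bigr)\,s[j_1,\dots,j_k],\qquad f(g_1t_1,\dots,g_kt_k)=\bigl(f(g_1,\dots,g_k)\bigr)(t_1\oplus\dots\oplus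 t_k)$$ for $f\in\mathcal P(k)$, $g_i\in\mathcal P(j_i)$, $s\in B_k$, $t_i\in B_{j_i}$. It is *closed* if it is equipped with $\mathbf{app}\in\mathcal P(2)$ such that for every $n$ and $p\in\mathcal P(n+1)$ there is a unique $\lambda(p)\in\mathcal P(n)$ with $\mathbf{app}(\lambda(p),\mathit{id})=p$. Homomorphisms of closed braided operads preserve $\mathit{id}$, composition, the braid group actions and $\mathbf{app}$ (hence $\lambda$). **Extensional $\mathbf{BC^\pm I}$-algebras.** These are sets $\mathcal A$ with a binary application (written by juxtaposition, associating to the left) and elements $\mathbf B,\mathbf C^+,\mathbf C^-,\mathbf I$ such that, with $a\circ b=\mathbf B\,a\,b$, for all $a,b,c\in\mathcal A$, for linked choices of $\pm,\mp$ and for any choice of $\star\in\{+,-\}$: $$\begin{aligned} &\mathbf B\,a\,b\,c=a\,(b\,c),\quad \mathbf C^\star a\,b\,c=a\,c\,b,\quad \mathbf I\,a=a,\quad \mathbf C^+a\,b=\mathbf C^-a\,b,\quad \mathbf B\,\mathbf I=\mathbf I,\quad \mathbf C^\star\mathbf B\,\mathbf I=\mathbf I,\\ &(\mathbf B\,\mathbf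 B)\circ\mathbf B=(\mathbf C^\star\mathbf B\,\mathbf B)\circ(\mathbf B\circ\mathbf B),\quad \mathbf C^\pm\circ\mathbf C^\mp=\mathbf I,\quad (\mathbf B\,\mathbf C^\pm)\circ(\mathbf B\circ\mathbf B)=(\mathbf C^\star\mathbf B\,\mathbf C^\pm)\circ(\mathbf B\circ\mathbf B),\\ &(\mathbf B\,\mathbf C^\pm)\circ(\mathbf C^\pm\circ(\mathbf B\,\mathbf C^\pm))=\mathbf C^\pm\circ((\mathbf B\,\mathbf C^\pm)\circ\mathbf C^\pm),\quad (\mathbf B\,\mathbf B)\circ\mathbf C^\pm=\mathbf C^\pm\circ((\mathbf B\,\mathbf C^\pm)\circ\mathbf B). \end{aligned}$$ Homomorphisms preserve the application and $\mathbf B,\mathbf C^+,\mathbf C^-,\mathbf I$. **The two constructions.** For a closed braided operad $\mathcal P$, the set $\mathcal P(0)$ carries the application $a\,b=\mathbf{app}(a,b)$ and the elements $\mathbf I=\lambda(\mathit{id})$, $\mathbf B=\lambda(\lambda(\lambda(\mathbf{app}(\mathit{id},\mathbf{app}))))$, $\mathbf C^\pm=\lambda(\lambda(\lambda(\mathbf{app}(\mathbf{app},\mathit{id})\,\sigma_2^{\pm1})))$;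 a homomorphism $\varphi$ is sent to its component $\varphi_0$. For an extensional $\mathbf{BC^\pm I}$-algebra $\mathcal A$, put $a^\bullet=\mathbf C^+\mathbf I\,a$, $\mathbf B^0=\mathbf I$, $\mathbf B^{m+1}=\mathbf B\circ\mathbf B^m$. The internal operad $\mathcal I_{\mathcal A}$ has $$\mathcal I_{\mathcal A}(m)=\{a^\bullet\circ\mathbf B^m\mid a\in\mathcal A\},\quad \mathit{id}=\mathbf I,\quad \mathbf{app}=\mathbf B,\quad g(f_1,\dots,f_n)=f_1\circ(\mathbf B\,f_2)\circ\dots\circ(\mathbf B^{n-1}f_n)\circ g,$$ and the right action of $B_m$ on $\mathcal I_{\mathcal A}(m)$ determined by $f\sigma_i=(\mathbf B^{i-1}\,\mathbf C^+)\circ f$ and $f\sigma_i^{-1}=(\mathbf B^{i-1}\,\mathbf C^-)\circ f$; a homomorphism $h:\mathcal A\to\mathcal A'$ is sent to its restrictions $\mathcal I_{\mathcal A}(m)\to\mathcal I_{\mathcal A'}(m)$. **Theorem.** $\mathcal A\mapsto\mathcal I_{\mathcal A}$ is a functor from the category of extensional $\mathbf{BC^\pm I}$-algebras to the category of closed braided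 operads, $\mathcal P\mapsto\mathcal P(0)$ is a functor in the opposite direction, and $\mathcal A\mapsto\mathcal I_{\mathcal A}$ is left adjoint to $\mathcal P\mapsto\mathcal P(0)$. -/

import Mathlib

/-- The Artin relations on the generators `σ_0, …, σ_{n-2}`. -/
def braidRels (n : ℕ) : Set (FreeGroup (Fin (n - 1))) :=
  {r | ∃ i j : Fin (n - 1), (i : ℕ) + 2 ≤ j ∧
      r = .of i * .of j * (.of j * .of i)⁻¹} ∪
  {r | ∃ i j : Fin (n - 1), (i : ℕ) + 1 = j ∧
      r = .of i * .of j * .of i * (.of j * .of i * .of j)⁻¹}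

/-- The Artin braid group on `n` strands (trivial for `n = 0, 1`). -/
abbrev BraidGroup (n : ℕ) : Type := PresentedGroup (braidRels n)

namespace BraidGroup

/-- The universal property of the presentation. -/
def lift {n : ℕ} {G : Type*} [Group G] (s : Fin (n - 1) → G)
    (far : ∀ i j : Fin (n - 1), (i : ℕ) + 2 ≤ j → s i * s j = s j * s i)
    (near : ∀ i j : Fin (n - 1), (i : ℕ) + 1 = j → s i * s j * s i = s j * s i * s j) :
    BraidGroup n →* G :=
  PresentedGroup.toGroup (f := s) (by
    rintro r (⟨i, j, h, rfl⟩ | ⟨i, j, h, rfl⟩)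
    · simp only [map_mul, map_inv, FreeGroup.lift_apply_of]
      rw [far i j h, mul_inv_cancel]
    · simp only [map_mul, map_inv, FreeGroup.lift_apply_of]
      rw [near i j h, mul_inv_cancel])

theorem lift_of {n : ℕ} {G : Type*} [Group G] (s : Fin (n - 1) → G) (far) (near)
    (i : Fin (n - 1)) : lift s far near (.of i) = s i :=
  PresentedGroup.toGroup.of _

/-- The generator `σ_i` of the braid group on `n` strands, which crosses the strands in positions
`i` and `i + 1`, positions being counted from `0`. (The value `1` for `i + 1 ≥ n` is never used.) -/
def σ (n i : ℕ) : BraidGroup n :=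
  if h : i < n - 1 then PresentedGroup.of ⟨i, h⟩ else 1

theorem σ_of {n : ℕ} (i : Fin (n - 1)) : σ n i = PresentedGroup.of i := by
  simp [σ]

theorem σ_far {n i j : ℕ} (h : i + 2 ≤ j) : σ n i * σ n j = σ n j * σ n i := by
  unfold σ
  split_ifs with hi hj <;> try simp
  refine mul_inv_eq_one.1 (PresentedGroup.one_of_mem (rels := braidRels n) (x :=
    .of ⟨i, hi⟩ * .of ⟨j, hj⟩ * (.of ⟨j, hj⟩ * .of ⟨i, hi⟩)⁻¹) (Or.inl ⟨_, _, h, rfl⟩))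

theorem σ_near {n i : ℕ} (h : i + 2 < n) :
    σ n i * σ n (i + 1) * σ n i = σ n (i + 1) * σ n i * σ n (i + 1) := by
  have hi : i < n - 1 := by omega
  have hj : i + 1 < n - 1 := by omega
  simp only [σ, hi, hj, dif_pos]
  refine mul_inv_eq_one.1 (PresentedGroup.one_of_mem (rels := braidRels n) (x :=
    .of ⟨i, hi⟩ * .of ⟨i + 1, hj⟩ * .of ⟨i, hi⟩ *
      (.of ⟨i + 1, hj⟩ * .of ⟨i, hi⟩ * .of ⟨i + 1, hj⟩)⁻¹) (Or.inr ⟨_, _, rfl, rfl⟩))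

/-- The transposition of the positions `i` and `i + 1`. -/
def adjSwap {n : ℕ} (i : Fin (n - 1)) : Equiv.Perm (Fin n) :=
  Equiv.swap ⟨i, by omega⟩ ⟨i + 1, by omega⟩

theorem adjSwap_val {n : ℕ} (i : Fin (n - 1)) (x : Fin n) :
    (adjSwap i x : ℕ) =
      if (x : ℕ) = i then (i : ℕ) + 1 else if (x : ℕ) = i + 1 then (i : ℕ) else x := by
  simp only [adjSwap, Equiv.swap_apply_def, Fin.ext_iff]
  split_ifs <;> rfl

theorem adjSwap_inv {n : ℕ} (i : Fin (n - 1)) : (adjSwap i)⁻¹ = adjSwap i :=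
  Equiv.swap_inv _ _

theorem swap_near {α : Type*} [DecidableEq α] {x y z : α} (h : x ≠ y) (h' : x ≠ z) (h'' : y ≠ z) :
    Equiv.swap x y * Equiv.swap y z * Equiv.swap x y =
      Equiv.swap y z * Equiv.swap x y * Equiv.swap y z := by
  rw [Equiv.swap_mul_swap_mul_swap h h', Equiv.swap_comm x y, Equiv.swap_comm y z,
    Equiv.swap_mul_swap_mul_swap h''.symm h'.symm, Equiv.swap_comm]

theorem adjSwap_near {n : ℕ} (i j : Fin (n - 1)) (h : (i : ℕ) + 1 = j) :
    adjSwap i * adjSwap j * adjSwap i = adjSwap j * adjSwap i * adjSwap j := by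
  obtain ⟨j, hj⟩ := j
  obtain rfl : (i : ℕ) + 1 = j := h
  exact swap_near (by simp [Fin.ext_iff]) (by simp [Fin.ext_iff]; omega) (by simp [Fin.ext_iff])

theorem adjSwap_far {n : ℕ} (i j : Fin (n - 1)) (h : (i : ℕ) + 2 ≤ j) :
    adjSwap i * adjSwap j = adjSwap j * adjSwap i := by
  ext x
  simp only [Equiv.Perm.mul_apply, adjSwap_val]
  split_ifs <;> omega

/-- The underlying permutation `|s|` of a braid `s`; the strand that starts in position `i` ends in
position `|s| i`. In a product `s * t` the braid `t` comes first. -/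
def perm {n : ℕ} : BraidGroup n →* Equiv.Perm (Fin n) :=
  lift adjSwap adjSwap_far adjSwap_near

/-- One strand in position `p` crosses the `b` strands in positions `p + 1, …, p + b`:
`σ_{p+b-1} ⋯ σ_{p+1} σ_p`. -/
def strandCross (n p : ℕ) : ℕ → BraidGroup n
  | 0 => 1
  | b + 1 => σ n (p + b) * strandCross n p b

/-- `a` parallel strands in positions `p, …, p + a - 1` cross the `b` parallel strands in positions
`p + a, …, p + a + b - 1`; all crossings are positive. -/
def blockCross (n p : ℕ) : ℕ → ℕ → BraidGroup n
  | 0, _ => 1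
  | a + 1, b => blockCross n p a b * strandCross n (p + a) b

theorem strandCross_comm {n p q : ℕ} (b : ℕ) (h : q + 2 ≤ p ∨ p + b + 1 ≤ q) :
    strandCross n p b * σ n q = σ n q * strandCross n p b := by
  induction b with
  | zero => simp [strandCross]
  | succ b ih =>
    have h1 : σ n (p + b) * σ n q = σ n q * σ n (p + b) := by
      rcases h with h | h
      · exact (σ_far (by omega)).symm
      · exact σ_far (by omega)
    rw [strandCross, mul_assoc, ih (by omega), ← mul_assoc, h1, mul_assoc]

theorem strandCross_pair {n p : ℕ} (b : ℕ) (h : p + b + 1 < n) :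
    strandCross n p b * strandCross n (p + 1) b * σ n p =
      σ n (p + b) * (strandCross n p b * strandCross n (p + 1) b) := by
  induction b with
  | zero => simp [strandCross]
  | succ b ih =>
    have ih := ih (by omega)
    have hc := strandCross_comm (n := n) (p := p) (q := p + b + 1) b (by omega)
    have hn := σ_near (n := n) (i := p + b) (by omega)
    have e : p + 1 + b = p + b + 1 := by omega
    simp only [strandCross, e, ← add_assoc]
    calc σ n (p + b) * strandCross n p b * (σ n (p + b + 1) * strandCross n (p + 1) b) * σ n p
        = σ n (p + b) * (strandCross n p b * σ n (p + b + 1)) * strandCross n (p + 1) b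
            * σ n p := by simp only [mul_assoc]
      _ = σ n (p + b) * σ n (p + b + 1) *
            (strandCross n p b * strandCross n (p + 1) b * σ n p) := by
          rw [hc]; simp only [mul_assoc]
      _ = (σ n (p + b) * σ n (p + b + 1) * σ n (p + b)) *
            (strandCross n p b * strandCross n (p + 1) b) := by
          rw [ih]; simp only [mul_assoc]
      _ = σ n (p + b + 1) * σ n (p + b) * (σ n (p + b + 1) * strandCross n p b) *
            strandCross n (p + 1) b := by rw [hn]; simp only [mul_assoc]
      _ = _ := by rw [← hc]; simp only [mul_assoc]

theorem blockCross_add (n p a a' b : ℕ) :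
    blockCross n p (a + a') b = blockCross n p a b * blockCross n (p + a) a' b := by
  induction a' with
  | zero => simp [blockCross]
  | succ a' ih => rw [← add_assoc, blockCross, ih, blockCross, mul_assoc, add_assoc p]

theorem blockCross_comm {n p q : ℕ} (a b : ℕ) (h : q + 2 ≤ p ∨ p + a + b ≤ q) :
    blockCross n p a b * σ n q = σ n q * blockCross n p a b := by
  induction a with
  | zero => simp [blockCross]
  | succ a ih =>
    rw [blockCross, mul_assoc, strandCross_comm _ (by omega), ← mul_assoc, ih (by omega),
      mul_assoc]

theorem blockCross_σ {n p r : ℕ} (a b : ℕ) (hr : r + 1 < a) (h : p + a + b ≤ n) :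
    blockCross n p a b * σ n (p + r) = σ n (p + b + r) * blockCross n p a b := by
  obtain ⟨d, rfl⟩ : ∃ d, a = r + 2 + d := ⟨a - (r + 2), by omega⟩
  have h2 : blockCross n (p + r) 2 b * σ n (p + r) =
      σ n (p + b + r) * blockCross n (p + r) 2 b := by
    have := strandCross_pair (n := n) (p := p + r) b (by omega)
    simpa [blockCross, show p + r + b = p + b + r by omega] using this
  have h3 : blockCross n p r b * σ n (p + b + r) = σ n (p + b + r) * blockCross n p r b :=
    blockCross_comm _ _ (by omega)
  rw [blockCross_add, blockCross_add, mul_assoc, blockCross_comm (p := p + (r + 2)) _ _ (by omega),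
    ← mul_assoc, mul_assoc (blockCross n p r b), h2, ← mul_assoc (blockCross n p r b), h3]
  simp only [mul_assoc]

theorem blockCross_blockCross_comm {n p q a b c d : ℕ} (h : p + a + b ≤ q) :
    blockCross n p a b * blockCross n q c d = blockCross n q c d * blockCross n p a b := by
  have h1 : ∀ e q, p + a + b ≤ q →
      blockCross n p a b * strandCross n q e = strandCross n q e * blockCross n p a b := by
    intro e q h
    induction e with
    | zero => simp [strandCross]
    | succ e ih =>
      rw [strandCross, ← mul_assoc, blockCross_comm _ _ (by omega), mul_assoc, ih, mul_assoc]
  induction c with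
  | zero => simp [blockCross]
  | succ c ih =>
    rw [blockCross, ← mul_assoc, ih, mul_assoc, h1 _ _ (by omega), mul_assoc]

theorem blockCross_slide {n p c N : ℕ} (hN : p + N + c ≤ n) {a b r : ℕ} (h : r + a + b ≤ N) :
    blockCross n p N c * blockCross n (p + r) a b =
      blockCross n (p + c + r) a b * blockCross n p N c := by
  have h1 : ∀ e r, r + 1 + e ≤ N →
      blockCross n p N c * strandCross n (p + r) e =
        strandCross n (p + c + r) e * blockCross n p N c := by
    intro e r h
    induction e with
    | zero => simp [strandCross]
    | succ e ih =>
      rw [strandCross, ← mul_assoc, add_assoc p, blockCross_σ _ _ (by omega) hN, mul_assoc,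
        ih (by omega), strandCross, mul_assoc, add_assoc (p + c)]
  induction a with
  | zero => simp [blockCross]
  | succ a ih =>
    rw [blockCross, ← mul_assoc, ih (by omega), mul_assoc, add_assoc p r a, h1 _ _ (by omega),
      blockCross, mul_assoc, add_assoc (p + c) r a]

/-- The Yang-Baxter equation for blocks of parallel strands. -/
theorem blockCross_near {n p a b c : ℕ} (h : p + a + b + c ≤ n) :
    blockCross n p b c * blockCross n (p + b) a c * blockCross n p a b =
      blockCross n (p + c) a b * blockCross n p a c * blockCross n (p + a) b c := by
  rw [← blockCross_add, mul_assoc, ← blockCross_add, add_comm b a]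
  simpa using blockCross_slide (n := n) (p := p) (c := c) (N := a + b) (by omega)
    (a := a) (b := b) (r := 0) (by omega)

/-- The number of strands that replace the strands before position `i`, if the `m`-th strand is
replaced by `j m` strands. -/
def offset {k : ℕ} (j : Fin k → ℕ) (i : ℕ) : ℕ := ∑ l ∈ Finset.univ.filter (fun l : Fin k => l.val < i), j l

theorem offset_succ {k : ℕ} (j : Fin k → ℕ) (i : Fin k) :
    offset j (i + 1) = offset j i + j i := by
  unfold offset
  have : (Finset.univ.filter fun l : Fin k => l.val < i.val + 1) =
      insert i (Finset.univ.filter fun l : Fin k => l.val < i.val) := by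
    ext l
    simp [Fin.ext_iff, Order.lt_add_one_iff, le_iff_eq_or_lt]
  rw [this, Finset.sum_insert (by simp), add_comm]

theorem offset_mono {k : ℕ} (j : Fin k → ℕ) {i i' : ℕ} (h : i ≤ i') :
    offset j i ≤ offset j i' := by
  refine Finset.sum_le_sum_of_subset fun l hl => ?_
  simp only [Finset.mem_filter, Finset.mem_univ, true_and] at hl ⊢
  omega

theorem offset_le {k : ℕ} (j : Fin k → ℕ) (i : ℕ) : offset j i ≤ ∑ l, j l :=
  Finset.sum_le_sum_of_subset (Finset.filter_subset _ _)

theorem offset_congr {k : ℕ} {j j' : Fin k → ℕ} {i : ℕ} (h : ∀ l : Fin k, (l : ℕ) < i → j l = j' l) :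
    offset j i = offset j' i :=
  Finset.sum_congr rfl fun l hl => h l (by simpa using hl)

theorem offset_comp {k : ℕ} (j : Fin k → ℕ) (π : Equiv.Perm (Fin k)) (i : ℕ)
    (h : ∀ l, (π l : ℕ) < i ↔ (l : ℕ) < i) : offset (j ∘ π) i = offset j i := by
  unfold offset
  rw [Finset.sum_filter, Finset.sum_filter,
    ← Equiv.sum_comp π fun l : Fin k => if l.val < i then j l else 0]
  simp [h]

/-- A permutation of `k` strands, together with a braid on `m = j_1 + ⋯ + j_k` strands for every
choice of the widths `j_1, …, j_k`. -/
@[ext]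
structure Cabling (k : ℕ) where
  perm : Equiv.Perm (Fin k)
  braid : ∀ (j : Fin k → ℕ) (m : ℕ), m = ∑ i, j i → BraidGroup m

namespace Cabling

theorem sum_comp {k m : ℕ} {j : Fin k → ℕ} (π : Equiv.Perm (Fin k)) (h : m = ∑ i, j i) :
    m = ∑ i, (j ∘ π) i := by
  rw [h]; exact (Equiv.sum_comp π j).symm

/-- Stacking: strands of widths `j` that pass through `t` arrive with widths `j ∘ t.perm⁻¹`. -/
instance {k : ℕ} : Group (Cabling k) where
  mul s t := ⟨s.perm * t.perm, fun j m h =>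
    s.braid (j ∘ ⇑t.perm⁻¹) m (sum_comp _ h) * t.braid j m h⟩
  one := ⟨1, fun _ _ _ => 1⟩
  inv s := ⟨s.perm⁻¹, fun j m h => (s.braid (j ∘ ⇑s.perm) m (sum_comp _ h))⁻¹⟩
  mul_assoc s t u := Cabling.ext (mul_assoc _ _ _) (by
    funext j m h; exact mul_assoc _ _ _)
  one_mul s := Cabling.ext (one_mul _) (by funext j m h; exact one_mul _)
  mul_one s := Cabling.ext (mul_one _) (by funext j m h; exact mul_one _)
  inv_mul_cancel s := Cabling.ext (inv_mul_cancel _) (by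
    funext j m h
    have e : (j ∘ ⇑s.perm⁻¹) ∘ ⇑s.perm = j := by funext x; simp
    change (s.braid ((j ∘ ⇑s.perm⁻¹) ∘ ⇑s.perm) m _)⁻¹ * s.braid j m h = 1
    simp only [e]
    exact inv_mul_cancel _)

/-- The cabling of the generator `σ_i`. -/
def gen {k : ℕ} (i : Fin (k - 1)) : Cabling k :=
  ⟨adjSwap i, fun j m _ => blockCross m (offset j i) (j ⟨i, by omega⟩) (j ⟨i + 1, by omega⟩)⟩

end Cabling

theorem Cabling.gen_far {k : ℕ} (i j : Fin (k - 1)) (h : (i : ℕ) + 2 ≤ j) :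
    Cabling.gen i * Cabling.gen j = Cabling.gen j * Cabling.gen i := by
  refine Cabling.ext (adjSwap_far i j h) ?_
  funext w m hm
  change blockCross m (offset (w ∘ ⇑(adjSwap j)⁻¹) i) (w ((adjSwap j)⁻¹ _)) (w ((adjSwap j)⁻¹ _)) *
      blockCross m (offset w j) (w _) (w _) =
    blockCross m (offset (w ∘ ⇑(adjSwap i)⁻¹) j) (w ((adjSwap i)⁻¹ _)) (w ((adjSwap i)⁻¹ _)) *
      blockCross m (offset w i) (w _) (w _)
  rw [adjSwap_inv, adjSwap_inv, offset_comp, offset_comp]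
  · have e : ∀ (i j : Fin (k - 1)) (x : Fin k), (x : ℕ) ≠ j → (x : ℕ) ≠ j + 1 →
        adjSwap j x = x := by
      intro i j x h1 h2
      ext
      rw [adjSwap_val, if_neg h1, if_neg h2]
    rw [e i j, e i j, e j i, e j i]
    · refine blockCross_blockCross_comm ?_
      have h1 := offset_succ w ⟨i, by omega⟩
      have h2 := offset_succ w ⟨i + 1, by omega⟩
      have h3 := offset_mono w h
      simp only at h1 h2
      have h4 : (i : ℕ) + 1 + 1 = i + 2 := rfl
      rw [h4] at h2
      omega
    all_goals simp only [ne_eq]; omega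
  · intro l; rw [adjSwap_val]; split_ifs <;> omega
  · intro l; rw [adjSwap_val]; split_ifs <;> omega

theorem Cabling.gen_near {k : ℕ} (i j : Fin (k - 1)) (h : (i : ℕ) + 1 = j) :
    Cabling.gen i * Cabling.gen j * Cabling.gen i =
      Cabling.gen j * Cabling.gen i * Cabling.gen j := by
  refine Cabling.ext (adjSwap_near i j h) ?_
  funext w m hm
  obtain ⟨j, hj⟩ := j
  obtain rfl : (i : ℕ) + 1 = j := h
  obtain ⟨i, hi⟩ := i
  have hk : i + 1 + 1 < k := by
    have : i + 1 < k - 1 := hj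
    omega
  have hii : ¬ i = i + 1 + 1 := by omega
  set s : Fin (k - 1) := ⟨i, hi⟩ with hs
  set t : Fin (k - 1) := ⟨i + 1, hj⟩ with ht
  set x : Fin k := ⟨i, by omega⟩ with hx
  set y : Fin k := ⟨i + 1, by omega⟩ with hy
  set z : Fin k := ⟨i + 1 + 1, hk⟩ with hz
  change
    blockCross m (offset ((w ∘ ⇑(adjSwap s)⁻¹) ∘ ⇑(adjSwap t)⁻¹) i)
        (w ((adjSwap s)⁻¹ ((adjSwap t)⁻¹ x))) (w ((adjSwap s)⁻¹ ((adjSwap t)⁻¹ y))) *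
      blockCross m (offset (w ∘ ⇑(adjSwap s)⁻¹) (y : ℕ))
        (w ((adjSwap s)⁻¹ y)) (w ((adjSwap s)⁻¹ z)) *
      blockCross m (offset w i) (w x) (w y) =
    blockCross m (offset ((w ∘ ⇑(adjSwap t)⁻¹) ∘ ⇑(adjSwap s)⁻¹) ((x : ℕ) + 1))
        (w ((adjSwap t)⁻¹ ((adjSwap s)⁻¹ y))) (w ((adjSwap t)⁻¹ ((adjSwap s)⁻¹ z))) *
      blockCross m (offset (w ∘ ⇑(adjSwap t)⁻¹) i)
        (w ((adjSwap t)⁻¹ x)) (w ((adjSwap t)⁻¹ y)) *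
      blockCross m (offset w ((x : ℕ) + 1)) (w y) (w z)
  have sx : adjSwap s x = y := Fin.ext (by rw [adjSwap_val]; simp [hs, hx, hy])
  have sy : adjSwap s y = x := Fin.ext (by rw [adjSwap_val]; simp [hs, hx, hy])
  have sz : adjSwap s z = z := Fin.ext (by rw [adjSwap_val]; simp [hs, hz, Ne.symm hii])
  have tx : adjSwap t x = x := Fin.ext (by rw [adjSwap_val]; simp [ht, hx, hii])
  have ty : adjSwap t y = z := Fin.ext (by rw [adjSwap_val]; simp [ht, hz, hy])
  have tz : adjSwap t z = y := Fin.ext (by rw [adjSwap_val]; simp [ht, hz, hy])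
  have hyx : (y : ℕ) = x + 1 := rfl
  have os : ∀ w : Fin k → ℕ, offset (w ∘ ⇑(adjSwap s)) i = offset w i := fun w =>
    offset_comp _ _ _ fun l => by rw [adjSwap_val]; split_ifs <;> simp_all
  have ot : ∀ w : Fin k → ℕ, offset (w ∘ ⇑(adjSwap t)) i = offset w i := fun w =>
    offset_comp _ _ _ fun l => by rw [adjSwap_val]; split_ifs <;> simp_all <;> omega
  simp only [adjSwap_inv]
  rw [hyx, offset_succ, offset_succ, offset_succ]
  simp only [Function.comp_apply, sx, sy, sz, tx, ty, tz]
  rw [show (x : ℕ) = i from rfl]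
  simp only [os, ot]
  refine blockCross_near ?_
  have h1 := offset_succ w x
  have h2 := offset_succ w y
  have h3 := offset_succ w z
  have h4 := offset_le w (z + 1)
  rw [← hm] at h4
  have h5 : (x : ℕ) = i := rfl
  have h6 : (y : ℕ) = i + 1 := rfl
  have h7 : (z : ℕ) = i + 1 + 1 := rfl
  rw [h5] at h1
  rw [h6] at h2
  rw [h7] at h3 h4
  omega

/-- Every braid with its underlying permutation and all its cablings. -/
def cabling {k : ℕ} : BraidGroup k →* Cabling k :=
  lift Cabling.gen Cabling.gen_far Cabling.gen_near

/-- The braid `s[j_1, …, j_k]` on `m = j_1 + ⋯ + j_k` strands that is obtained from `s` when the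
strand that starts in position `i` is replaced by `j i` parallel strands (is deleted if
`j i = 0`). -/
def cable {k : ℕ} (s : BraidGroup k) (j : Fin k → ℕ) {m : ℕ} (h : m = ∑ i, j i) : BraidGroup m :=
  (cabling s).braid j m h

theorem cabling_perm {k : ℕ} (s : BraidGroup k) : (cabling s).perm = perm s := by
  let p : Cabling k →* Equiv.Perm (Fin k) :=
    { toFun := Cabling.perm, map_one' := rfl, map_mul' := fun _ _ => rfl }
  suffices p.comp cabling = perm from DFunLike.congr_fun this s
  refine PresentedGroup.ext fun i => ?_
  simp only [MonoidHom.comp_apply, cabling, perm, lift_of]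
  rfl

theorem cable_one {k : ℕ} (j : Fin k → ℕ) {m : ℕ} (h : m = ∑ i, j i) :
    cable (1 : BraidGroup k) j h = 1 := by
  unfold cable
  rw [map_one]
  rfl

theorem cable_mul {k : ℕ} (s t : BraidGroup k) (j : Fin k → ℕ) {m : ℕ} (h : m = ∑ i, j i) :
    cable (s * t) j h =
      cable s (j ∘ ⇑(perm t)⁻¹) (Cabling.sum_comp _ h) * cable t j h := by
  unfold cable
  simp only [map_mul, ← cabling_perm]
  rfl

theorem cable_σ {k i : ℕ} (hi : i + 1 < k) (j : Fin k → ℕ) {m : ℕ} (h : m = ∑ l, j l) :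
    cable (σ k i) j h = blockCross m (offset j i) (j ⟨i, by omega⟩) (j ⟨i + 1, hi⟩) := by
  have := σ_of (n := k) ⟨i, by omega⟩
  simp only at this
  rw [cable, this, cabling, lift_of]
  rfl

/-- The braid `s` on `j` strands placed on the strands `p, …, p + j - 1` of `m` strands. -/
def place {j m : ℕ} (p : ℕ) (h : p + j ≤ m) : BraidGroup j →* BraidGroup m :=
  lift (fun i => σ m (p + i))
    (fun _ _ h' => σ_far (by omega))
    (fun i i' h' => by
      rw [← h', ← add_assoc]
      exact σ_near (by omega))

/-- The block direct sum `t_1 ⊕ ⋯ ⊕ t_k` on `m = j_1 + ⋯ + j_k` strands. -/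
def directSum {k : ℕ} {j : Fin k → ℕ} (t : ∀ i, BraidGroup (j i)) {m : ℕ} (h : m = ∑ i, j i) :
    BraidGroup m :=
  (List.ofFn fun i : Fin k => place (offset j i)
    (by rw [← offset_succ, h]; exact offset_le j _) (t i)).prod

end BraidGroup

universe u

/-- An applicative structure with distinguished elements `B`, `C⁺`, `C⁻`, `I`. -/
class BCStructure (A : Type u) where
  app : A → A → A
  B : A
  Cpos : A
  Cneg : A
  I : A

namespace BCStructure

infixl:75 " ⬝ " => BCStructure.app

/-- `C true = C⁺` and `C false = C⁻`. -/
def C {A : Type u} [BCStructure A] : Bool → A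
  | true => Cpos
  | false => Cneg

/-- The composition `a ∘ b = B a b`. -/
def cmp {A : Type u} [BCStructure A] (a b : A) : A := B ⬝ a ⬝ b

infixr:70 " ⊚ " => BCStructure.cmp

/-- `a^• = C⁺ I a`. -/
def bullet {A : Type u} [BCStructure A] (a : A) : A := Cpos ⬝ I ⬝ a

/-- The `m`-fold composite `B^m = B ∘ ⋯ ∘ B`, with `B^0 = I`. -/
def bpow {A : Type u} [BCStructure A] : ℕ → A
  | 0 => I
  | m + 1 => B ⊚ bpow m

end BCStructure

open BCStructure in
/-- The axioms of extensional `BC^±I`-algebras. The sign `s` stands for `±`, then `!s` for `∓`; the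
sign `t` stands for an arbitrary choice. -/
class IsExtensionalBC (A : Type u) [BCStructure A] : Prop where
  B_app : ∀ a b c : A, B ⬝ a ⬝ b ⬝ c = a ⬝ (b ⬝ c)
  C_app : ∀ (t : Bool) (a b c : A), C t ⬝ a ⬝ b ⬝ c = a ⬝ c ⬝ b
  I_app : ∀ a : A, I ⬝ a = a
  C_two : ∀ a b : A, Cpos ⬝ a ⬝ b = Cneg ⬝ a ⬝ b
  lam : (B : A) ⬝ I = I
  rho : ∀ t : Bool, (C t : A) ⬝ B ⬝ I = I
  alpha : ∀ t : Bool, (B ⬝ B : A) ⊚ B = (C t ⬝ B ⬝ B) ⊚ (B ⊚ B)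
  cox_one : ∀ s : Bool, (C s : A) ⊚ C (!s) = I
  cox_two : ∀ s t : Bool, (B ⬝ C s : A) ⊚ (B ⊚ B) = (C t ⬝ B ⬝ C s) ⊚ (B ⊚ B)
  cox_three : ∀ s : Bool, (B ⬝ C s : A) ⊚ (C s ⊚ (B ⬝ C s)) = C s ⊚ ((B ⬝ C s) ⊚ C s)
  bc : ∀ s : Bool, (B ⬝ B : A) ⊚ C s = C s ⊚ ((B ⬝ C s) ⊚ B)

namespace BCStructure

theorem B_app_app {A : Type u} [BCStructure A] (a b : A) : B ⬝ a ⬝ b = a ⊚ b := rfl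

section Arity

open IsExtensionalBC

variable {A : Type u} [BCStructure A] [IsExtensionalBC A]

theorem cmp_app (a b c : A) : (a ⊚ b) ⬝ c = a ⬝ (b ⬝ c) := B_app a b c

theorem B_exch (y : A) : B ⊚ (B ⬝ y) = (B ⬝ (B ⬝ y)) ⊚ B := by
  have h := congrArg (· ⬝ y) (alpha (A := A) true)
  simpa only [cmp_app, C_app, B_app_app] using h

theorem L_cmp (y x : A) : B ⬝ (y ⊚ x) = (B ⬝ y) ⊚ (B ⬝ x) := by
  have h := congrArg (· ⬝ x) (B_exch y)
  simpa only [cmp_app, B_app_app] using h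

theorem cmp_assoc (x y z : A) : (x ⊚ y) ⊚ z = x ⊚ (y ⊚ z) := by
  have h := congrArg (· ⬝ z) (L_cmp x y)
  simpa only [cmp_app, B_app_app] using h

theorem I_cmp (x : A) : I ⊚ x = x := by
  rw [← B_app_app, lam, I_app]

theorem cmp_I (x : A) : x ⊚ I = x := by
  have h := congrArg (· ⬝ x) (rho (A := A) true)
  simpa only [C_app, I_app, B_app_app] using h

theorem C_any (s t : Bool) (a b : A) : C s ⬝ a ⬝ b = C t ⬝ a ⬝ b := by
  have := C_two a b
  cases s <;> cases t <;> simp [C, this]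

theorem bullet_app (a b : A) : bullet a ⬝ b = b ⬝ a := by
  have := C_app true (I : A) a b
  rw [I_app] at this
  exact this

theorem B_cmp_C (s : Bool) (f : A) : B ⊚ (C s ⬝ f) = C s ⬝ (C s ⊚ (B ⬝ f)) := by
  have h := congrArg (· ⬝ f) (bc (A := A) s)
  simpa only [cmp_app, B_app_app] using h

theorem C_app_cmp (s : Bool) (f a b : A) : (C s ⬝ f ⬝ a) ⊚ b = C s ⬝ (f ⊚ b) ⬝ a := by
  have h := congrArg (· ⬝ a ⬝ b) (B_cmp_C s f)
  simpa only [cmp_app, C_app, B_app_app] using h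

theorem C_eq_bullet (s : Bool) (b a : A) : C s ⬝ b ⬝ a = bullet a ⊚ b := by
  rw [C_any s true]
  have h := C_app_cmp true I a b
  rw [I_cmp] at h
  exact h.symm

theorem L_bullet (s : Bool) (a : A) : B ⬝ bullet a = bullet a ⊚ C s := by
  have h := congrArg (· ⬝ a) (B_cmp_C s (I : A))
  simp only [lam, cmp_I, cmp_app] at h
  rw [C_eq_bullet, C_eq_bullet, cmp_I] at h
  exact h

theorem C_inv (s : Bool) (x : A) : C s ⊚ (C (!s) ⊚ x) = x := by
  rw [← cmp_assoc, cox_one, I_cmp]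

theorem C_inv' (s : Bool) (x : A) : C (!s) ⊚ (C s ⊚ x) = x := by
  have := C_inv (!s) x
  rwa [Bool.not_not] at this

theorem bc' (s : Bool) : (B : A) ⊚ C s = (B ⬝ C s) ⊚ (C s ⊚ (B ⬝ B)) := by
  have h := bc (A := A) (!s)
  have h1 : (B ⬝ C s : A) ⊚ (C s ⊚ ((B ⬝ B) ⊚ C (!s))) = B := by
    rw [h, C_inv, ← cmp_assoc, ← L_cmp, cox_one, lam, I_cmp]
  calc (B : A) ⊚ C s = ((B ⬝ C s : A) ⊚ (C s ⊚ ((B ⬝ B) ⊚ C (!s)))) ⊚ C s := by rw [h1]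
    _ = (B ⬝ C s) ⊚ (C s ⊚ ((B ⬝ B) ⊚ (C (!s) ⊚ (C s ⊚ I)))) := by
      simp only [cmp_assoc, cmp_I]
    _ = _ := by rw [C_inv', cmp_I]

theorem L_C_app (s : Bool) (f : A) : B ⬝ (C s ⬝ f) = C s ⊚ (C s ⬝ (B ⊚ f)) := by
  have h := congrArg (· ⬝ f) (bc' (A := A) s)
  simpa only [cmp_app, B_app_app] using h

theorem bullet_of_app (a b : A) : bullet (a ⬝ b) = bullet b ⊚ (bullet a ⊚ B) := by
  have h := congrArg (· ⬝ a ⬝ b) (L_C_app true (I : A))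
  simp only [cmp_app, cmp_I, B_app_app, C_eq_bullet] at h
  exact h

theorem bullet_I_cmp_B : bullet (I : A) ⊚ B = I := by
  rw [← C_eq_bullet true, rho]

theorem C_arity' (s : Bool) :
    bullet (C s : A) ⊚ (B ⊚ (B ⊚ B)) = (B ⬝ C s) ⊚ (B ⊚ B) := by
  rw [cox_two s true, C_eq_bullet, cmp_assoc]

theorem bullet_C_I : bullet (C true ⬝ I : A) ⊚ (B ⊚ B) = C true ⊚ B := by
  have h : (B ⬝ C true : A) ⊚ B = C false ⊚ ((B ⬝ B) ⊚ C true) := by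
    have := bc (A := A) true
    rw [this]
    exact (C_inv' true _).symm
  rw [bullet_of_app]
  simp only [cmp_assoc]
  rw [C_arity', ← cmp_assoc (B ⬝ C true), h]
  simp only [cmp_assoc]
  rw [← cmp_assoc (bullet I), ← L_bullet, ← cmp_assoc, ← L_cmp, bullet_I_cmp_B, lam, I_cmp]

theorem bullet_bullet (a : A) : bullet (bullet a) ⊚ B = (B ⬝ bullet a) ⊚ B := by
  have h1 : (C true ⬝ B : A) ⊚ (C true ⬝ I) = C true ⬝ (C true ⊚ B) := by
    rw [← B_app_app, L_C_app, cmp_app, C_eq_bullet, bullet_C_I]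
  have h2 := congrArg (· ⬝ a) h1
  simp only [cmp_app] at h2
  rw [C_eq_bullet true _ (C true ⬝ I ⬝ a)] at h2
  calc bullet (bullet a) ⊚ B = C true ⬝ (C true ⊚ B) ⬝ a := h2
    _ = (B ⬝ bullet a) ⊚ B := by
      rw [C_eq_bullet, L_bullet true, cmp_assoc]

theorem cmp_bullet (y a : A) : y ⊚ bullet a = bullet a ⊚ (B ⬝ y) := by
  have h := congrArg (· ⬝ y) (bullet_bullet a)
  simp only [cmp_app, bullet_app] at h
  exact h

theorem bpow_succ' (m : ℕ) : (bpow (m + 1) : A) = bpow m ⊚ B := by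
  induction m with
  | zero => simp only [bpow, I_cmp, cmp_I]
  | succ m ih =>
    change B ⊚ bpow (m + 1) = (B ⊚ bpow m) ⊚ B
    rw [ih, cmp_assoc]

theorem bpow_add (m n : ℕ) : (bpow (m + n) : A) = bpow m ⊚ bpow n := by
  induction m with
  | zero => rw [Nat.zero_add]; exact (I_cmp _).symm
  | succ m ih =>
    rw [Nat.succ_add]
    change B ⊚ bpow (m + n) = (B ⊚ bpow m) ⊚ bpow n
    rw [ih, cmp_assoc]

theorem bpow_succ_app (m : ℕ) (x : A) : bpow (m + 1) ⬝ x = B ⬝ (bpow m ⬝ x) := cmp_app _ _ _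

theorem bpow_zero_app (x : A) : bpow 0 ⬝ x = x := I_app x

theorem bpow_add_app (m n : ℕ) (x : A) : bpow (m + n) ⬝ x = bpow m ⬝ (bpow n ⬝ x) := by
  rw [bpow_add, cmp_app]

theorem bpow_app_cmp (m : ℕ) (x y : A) : bpow m ⬝ (x ⊚ y) = (bpow m ⬝ x) ⊚ (bpow m ⬝ y) := by
  induction m with
  | zero => simp only [bpow_zero_app]
  | succ m ih => simp only [bpow_succ_app, ih, L_cmp]

theorem bpow_app_I (m : ℕ) : bpow m ⬝ (I : A) = I := by
  induction m with
  | zero => exact bpow_zero_app I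
  | succ m ih => rw [bpow_succ_app, ih, lam]

/-- `x` has arity `m → n`. -/
def Arity (m n : ℕ) (x : A) : Prop := bullet x ⊚ bpow (m + 1) = (B ⬝ x) ⊚ bpow n

theorem Arity.exch {m n : ℕ} {x : A} (h : Arity m n x) (y : A) :
    (bpow m ⬝ y) ⊚ x = x ⊚ (bpow n ⬝ y) := by
  have h := congrArg (· ⬝ y) h
  simpa only [cmp_app, bullet_app, bpow_succ_app, B_app_app] using h

theorem Arity.cmp {l m n : ℕ} {x y : A} (hx : Arity l m x) (hy : Arity m n y) :
    Arity l n (x ⊚ y) := by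
  have hB : bullet (B : A) ⊚ (B ⊚ (B ⊚ B)) = (B ⬝ B) ⊚ B := by
    rw [alpha true, C_eq_bullet, cmp_assoc]
  have h1 : bullet (x ⊚ y) = bullet y ⊚ (bullet x ⊚ (bullet B ⊚ (B ⊚ B))) := by
    rw [← B_app_app, bullet_of_app, bullet_of_app, cmp_assoc, cmp_assoc]
  unfold Arity
  calc bullet (x ⊚ y) ⊚ bpow (l + 1)
      = bullet y ⊚ (bullet x ⊚ ((bullet B ⊚ (B ⊚ (B ⊚ B))) ⊚ bpow l)) := by
        rw [h1, bpow]; simp only [cmp_assoc]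
    _ = bullet y ⊚ ((bullet x ⊚ (B ⬝ B)) ⊚ bpow (l + 1)) := by
        rw [hB, bpow]; simp only [cmp_assoc]
    _ = bullet y ⊚ (B ⊚ (bullet x ⊚ bpow (l + 1))) := by
        rw [← cmp_bullet, cmp_assoc]
    _ = bullet y ⊚ ((B ⊚ (B ⬝ x)) ⊚ bpow m) := by rw [hx, cmp_assoc]
    _ = (bullet y ⊚ (B ⬝ (B ⬝ x))) ⊚ bpow (m + 1) := by
        rw [B_exch, bpow]; simp only [cmp_assoc]
    _ = (B ⬝ x) ⊚ (bullet y ⊚ bpow (m + 1)) := by rw [← cmp_bullet, cmp_assoc]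
    _ = (B ⬝ (x ⊚ y)) ⊚ bpow n := by rw [hy, L_cmp, cmp_assoc]

theorem arity_B : Arity 2 1 (B : A) := by
  unfold Arity
  simp only [bpow, cmp_I]
  rw [alpha true, C_eq_bullet, cmp_assoc]

theorem arity_I : Arity 0 0 (I : A) := by
  unfold Arity
  simp only [bpow, cmp_I]
  rw [bullet_I_cmp_B, lam]

theorem arity_C (s : Bool) : Arity 2 2 (C s : A) := by
  unfold Arity
  simp only [bpow, cmp_I]
  exact C_arity' s

theorem arity_bullet (a : A) : Arity 0 1 (bullet a) := by
  unfold Arity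
  simp only [bpow, cmp_I]
  exact bullet_bullet a

theorem Arity.B_app {m n : ℕ} {x : A} (h : Arity m n x) : Arity (m + 1) (n + 1) (B ⬝ x) := by
  have hB : bullet (B : A) ⊚ (B ⊚ (B ⊚ B)) = (B ⬝ B) ⊚ B := by
    rw [alpha true, C_eq_bullet, cmp_assoc]
  unfold Arity
  calc bullet (B ⬝ x) ⊚ bpow (m + 1 + 1)
      = bullet x ⊚ ((bullet B ⊚ (B ⊚ (B ⊚ B))) ⊚ bpow m) := by
        rw [bullet_of_app, bpow, bpow]; simp only [cmp_assoc]
    _ = (bullet x ⊚ (B ⬝ B)) ⊚ bpow (m + 1) := by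
        rw [hB, bpow]; simp only [cmp_assoc]
    _ = B ⊚ (bullet x ⊚ bpow (m + 1)) := by rw [← cmp_bullet, cmp_assoc]
    _ = (B ⊚ (B ⬝ x)) ⊚ bpow n := by rw [h, cmp_assoc]
    _ = (B ⬝ (B ⬝ x)) ⊚ bpow (n + 1) := by rw [B_exch, bpow, cmp_assoc]

theorem Arity.succ {m n : ℕ} {x : A} (h : Arity m n x) : Arity (m + 1) (n + 1) x := by
  unfold Arity at h ⊢
  rw [bpow_succ' (m + 1), ← cmp_assoc, h, bpow_succ' n, cmp_assoc]

theorem Arity.add {m n : ℕ} {x : A} (h : Arity m n x) (d : ℕ) : Arity (m + d) (n + d) x := by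
  induction d with
  | zero => exact h
  | succ d ih => exact ih.succ

theorem Arity.bpow_app {m n : ℕ} {x : A} (h : Arity m n x) (r : ℕ) :
    Arity (m + r) (n + r) (bpow r ⬝ x) := by
  induction r with
  | zero => rwa [bpow_zero_app]
  | succ r ih => rw [bpow_succ_app]; exact ih.B_app

theorem arity_bpow (m : ℕ) : Arity (m + 1) 1 (bpow m : A) := by
  induction m with
  | zero => exact arity_I.add 1
  | succ m ih =>
    have h := (arity_B (A := A)).add m
    rw [show 2 + m = m + 1 + 1 by omega, show 1 + m = m + 1 by omega] at h
    exact h.cmp ih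

/-- The elements `a^• ∘ B^m` are those of arity `m → 1`. -/
theorem exists_bullet_iff {m : ℕ} {x : A} : (∃ a, x = bullet a ⊚ bpow m) ↔ Arity m 1 x := by
  constructor
  · rintro ⟨a, rfl⟩
    have h := (arity_bullet a).add m
    rw [show 0 + m = m by omega, show 1 + m = m + 1 by omega] at h
    exact h.cmp (arity_bpow m)
  · intro h
    refine ⟨x ⬝ I, ?_⟩
    rw [bullet_of_app]
    simp only [cmp_assoc]
    change x = bullet I ⊚ (bullet x ⊚ bpow (m + 1))
    rw [h, ← cmp_assoc, ← cmp_bullet, cmp_assoc]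
    simp only [bpow, cmp_I]
    rw [bullet_I_cmp_B, cmp_I]

theorem arity_foldr (n : ℕ) : ∀ (k : Fin n → ℕ) (f : Fin n → A) (g : A) (q r : ℕ),
    (∀ i, Arity (k i) 1 (f i)) → Arity (n + r) q g →
    Arity ((∑ i, k i) + r) q
      ((List.ofFn fun i : Fin n => bpow (i + r) ⬝ f i).foldr BCStructure.cmp g) := by
  induction n with
  | zero => intro k f g q r _ hg; simpa using hg
  | succ n ih =>
    intro k f g q r hf hg
    rw [List.ofFn_succ, List.foldr_cons, Fin.sum_univ_succ]
    have h1 := ih (fun i => k i.succ) (fun i => f i.succ) g q (r + 1) (fun i => hf _)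
      (by rwa [show n + (r + 1) = n + 1 + r by omega])
    have h2 := ((hf 0).bpow_app r).add (∑ i : Fin n, k i.succ)
    rw [show k 0 + r + ∑ i : Fin n, k i.succ = k 0 + ∑ i : Fin n, k i.succ + r by omega,
      show 1 + r + ∑ i : Fin n, k i.succ = ∑ i : Fin n, k i.succ + (r + 1) by omega] at h2
    have e : ∀ i : Fin n, (i.succ : ℕ) + r = i + (r + 1) := fun i => by simp; omega
    simp only [e, Fin.val_zero, Nat.zero_add]
    exact h2.cmp h1

theorem arity_braid {m i : ℕ} (hi : i + 1 < m) (s : Bool) :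
    Arity m m (bpow i ⬝ C s : A) := by
  have h := ((arity_C (A := A) s).bpow_app i).add (m - (i + 2))
  rwa [show 2 + i + (m - (i + 2)) = m by omega] at h

theorem braid_far {i j : ℕ} (h : i + 2 ≤ j) (s : Bool) :
    (bpow i ⬝ C s : A) ⊚ (bpow j ⬝ C s) = (bpow j ⬝ C s) ⊚ (bpow i ⬝ C s) := by
  obtain ⟨d, rfl⟩ := Nat.exists_eq_add_of_le h
  rw [add_assoc, bpow_add_app, ← bpow_app_cmp, ← bpow_app_cmp, bpow_add_app, (arity_C s).exch]

theorem braid_near (i : ℕ) (s : Bool) :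
    (bpow i ⬝ C s : A) ⊚ ((bpow (i + 1) ⬝ C s) ⊚ (bpow i ⬝ C s)) =
      (bpow (i + 1) ⬝ C s) ⊚ ((bpow i ⬝ C s) ⊚ (bpow (i + 1) ⬝ C s)) := by
  have e : (bpow 1 ⬝ C s : A) = B ⬝ C s := by rw [bpow_succ_app, bpow_zero_app]
  simp only [bpow_add_app i 1, e, ← bpow_app_cmp, cox_three]

theorem braid_inv (i : ℕ) (s : Bool) (x : A) :
    (bpow i ⬝ C s : A) ⊚ ((bpow i ⬝ C (!s)) ⊚ x) = x := by
  rw [← cmp_assoc, ← bpow_app_cmp, cox_one, bpow_app_I, I_cmp]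

end Arity

end BCStructure

open CategoryTheory

/-- The operations of a braided operad with an application: `Op n` is the set of `n`-ary operators,
`comp g f` is `g(f_1, …, f_n)`, and `act f s` is `f s`. The arity of a composite is given as a number
`m` together with a proof that `m = k_1 + ⋯ + k_n`. -/
structure OperadData : Type (u + 1) where
  Op : ℕ → Type u
  one : Op 1
  comp : ∀ {n m : ℕ} {k : Fin n → ℕ}, Op n → (∀ i, Op (k i)) → m = ∑ i, k i → Op m
  act : ∀ {n : ℕ}, Op n → BraidGroup n → Op n
  app : Op 2

namespace OperadData

/-- `app(x, y)`. -/
def apply (P : OperadData.{u}) {a b m : ℕ} (x : P.Op a) (y : P.Op b) (h : m = a + b) : P.Op m :=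
  P.comp (k := ![a, b]) P.app (Fin.cons x (Fin.cons y finZeroElim)) (by simpa using h)

theorem sum_flatten {n N : ℕ} {k r : Fin n → ℕ} {l : ∀ i, Fin (k i) → ℕ}
    (hr : ∀ i, r i = ∑ j, l i j) (h : N = ∑ i, r i) :
    N = ∑ p : Fin (∑ i, k i), l (finSigmaFinEquiv.symm p).1 (finSigmaFinEquiv.symm p).2 := by
  rw [h, Equiv.sum_comp finSigmaFinEquiv.symm fun p : (i : Fin n) × Fin (k i) => l p.1 p.2,
    Fintype.sum_sigma]
  exact Finset.sum_congr rfl fun i _ => hr i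

/-- The unit laws and the associativity of composition. In the latter, position `p` of
`h(g_1, …, g_n)` is the position `j` of `g_i` for `(i, j) = finSigmaFinEquiv.symm p`. -/
structure IsOperad (P : OperadData.{u}) : Prop where
  comp_one : ∀ {n : ℕ} (f : P.Op n), P.comp (k := fun _ => 1) f (fun _ => P.one) (by simp) = f
  one_comp : ∀ {n : ℕ} (f : P.Op n), P.comp (k := fun _ => n) P.one (fun _ => f) (by simp) = f
  comp_assoc : ∀ {n N : ℕ} {k r : Fin n → ℕ} {l : ∀ i, Fin (k i) → ℕ} (h : P.Op n)
    (g : ∀ i, P.Op (k i)) (f : ∀ i j, P.Op (l i j)) (hr : ∀ i, r i = ∑ j, l i j)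
    (hN : N = ∑ i, r i),
    P.comp h (fun i => P.comp (g i) (f i) (hr i)) hN =
      P.comp (P.comp h g rfl)
        (fun p => f (finSigmaFinEquiv.symm p).1 (finSigmaFinEquiv.symm p).2)
        (sum_flatten hr hN)

/-- Right actions of the braid groups, with the two equivariance conditions
`(f s)(g_1, …, g_k) = (f(g_{s⁻¹(1)}, …, g_{s⁻¹(k)})) s[j_1, …, j_k]` and
`f(g_1 t_1, …, g_k t_k) = (f(g_1, …, g_k)) (t_1 ⊕ ⋯ ⊕ t_k)`. -/
structure IsBraidedOperad (P : OperadData.{u}) : Prop extends P.IsOperad where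
  act_one : ∀ {n : ℕ} (f : P.Op n), P.act f 1 = f
  act_mul : ∀ {n : ℕ} (f : P.Op n) (s t : BraidGroup n), P.act f (s * t) = P.act (P.act f s) t
  act_comp : ∀ {k m : ℕ} {j : Fin k → ℕ} (f : P.Op k) (s : BraidGroup k) (g : ∀ i, P.Op (j i))
    (h : m = ∑ i, j i),
    P.comp (P.act f s) g h =
      P.act (P.comp (k := fun i => j ((BraidGroup.perm s)⁻¹ i)) f
        (fun i => g ((BraidGroup.perm s)⁻¹ i)) (BraidGroup.Cabling.sum_comp _ h))
        (BraidGroup.cable s j h)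
  comp_act : ∀ {k m : ℕ} {j : Fin k → ℕ} (f : P.Op k) (g : ∀ i, P.Op (j i))
    (t : ∀ i, BraidGroup (j i)) (h : m = ∑ i, j i),
    P.comp f (fun i => P.act (g i) (t i)) h = P.act (P.comp f g h) (BraidGroup.directSum t h)

/-- Closedness: for every `p ∈ P(n + 1)` there is a unique `q ∈ P(n)` with `app(q, id) = p`. -/
structure IsClosedBraidedOperad (P : OperadData.{u}) : Prop extends P.IsBraidedOperad where
  closed : ∀ {n : ℕ} (p : P.Op (n + 1)), ∃! q : P.Op n, P.apply q P.one rfl = p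

/-- Operad homomorphisms that preserve the braid group actions and the application (and hence also
the abstraction, by uniqueness). -/
structure IsHom (P Q : OperadData.{u}) (φ : ∀ n, P.Op n → Q.Op n) : Prop where
  map_one : φ 1 P.one = Q.one
  map_comp : ∀ {n m : ℕ} {k : Fin n → ℕ} (g : P.Op n) (f : ∀ i, P.Op (k i)) (h : m = ∑ i, k i),
    φ m (P.comp g f h) = Q.comp (φ n g) (fun i => φ (k i) (f i)) h
  map_act : ∀ {n : ℕ} (f : P.Op n) (s : BraidGroup n), φ n (P.act f s) = Q.act (φ n f) s
  map_app : φ 2 P.app = Q.app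

end OperadData

/-- Closed braided operads. -/
structure ClosedBraidedOperad : Type (u + 1) extends OperadData.{u} where
  laws : toOperadData.IsClosedBraidedOperad

namespace ClosedBraidedOperad

/-- Homomorphisms of closed braided operads. -/
@[ext]
structure Hom (P Q : ClosedBraidedOperad.{u}) : Type u where
  toFun : ∀ n, P.Op n → Q.Op n
  isHom : OperadData.IsHom P.toOperadData Q.toOperadData toFun

instance : Category.{u} ClosedBraidedOperad.{u} where
  Hom := Hom
  id P := ⟨fun _ f => f, ⟨rfl, fun _ _ _ => rfl, fun _ _ => rfl, rfl⟩⟩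
  comp φ ψ := ⟨fun n f => ψ.toFun n (φ.toFun n f),
    ⟨by rw [φ.isHom.map_one, ψ.isHom.map_one],
     fun g f h => by rw [φ.isHom.map_comp, ψ.isHom.map_comp],
     fun f s => by rw [φ.isHom.map_act, ψ.isHom.map_act],
     by rw [φ.isHom.map_app, ψ.isHom.map_app]⟩⟩

/-- The abstraction `λ(p)`: the unique `q` with `app(q, id) = p`. -/
noncomputable def abs (P : ClosedBraidedOperad.{u}) {n : ℕ} (p : P.Op (n + 1)) : P.Op n :=
  (P.laws.closed p).choose

/-- The applicative structure `P(0)`, with `B = λλλ(app(id, app))`, `I = λ(id)` and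
`C^± = λλλ(app(app, id) σ^{±1})`, where `σ` crosses the second and the third strand. -/
noncomputable abbrev zeroStructure (P : ClosedBraidedOperad.{u}) : BCStructure (P.Op 0) where
  app a b := P.apply a b rfl
  B := P.abs (P.abs (P.abs (P.apply P.one P.app rfl)))
  Cpos := P.abs (P.abs (P.abs (P.act (P.apply P.app P.one rfl) (BraidGroup.σ 3 1))))
  Cneg := P.abs (P.abs (P.abs (P.act (P.apply P.app P.one rfl) (BraidGroup.σ 3 1)⁻¹)))
  I := P.abs P.one

end ClosedBraidedOperad

/-- Maps preserving the application and the constants `B`, `C⁺`, `C⁻`, `I`. -/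
structure IsBCHom {A A' : Type u} (SA : BCStructure A) (SA' : BCStructure A') (h : A → A') :
    Prop where
  map_app : ∀ a b, h (SA.app a b) = SA'.app (h a) (h b)
  map_B : h SA.B = SA'.B
  map_Cpos : h SA.Cpos = SA'.Cpos
  map_Cneg : h SA.Cneg = SA'.Cneg
  map_I : h SA.I = SA'.I

/-- Extensional `BC^±I`-algebras. -/
structure ExtBCAlgebra : Type (u + 1) where
  carrier : Type u
  [str : BCStructure carrier]
  [ext : IsExtensionalBC carrier]

namespace ExtBCAlgebra

attribute [instance] ExtBCAlgebra.str ExtBCAlgebra.ext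

/-- Homomorphisms of extensional `BC^±I`-algebras. -/
@[ext]
structure Hom (A A' : ExtBCAlgebra.{u}) : Type u where
  toFun : A.carrier → A'.carrier
  isHom : IsBCHom A.str A'.str toFun

instance : Category.{u} ExtBCAlgebra.{u} where
  Hom := Hom
  id A := ⟨fun a => a, ⟨fun _ _ => rfl, rfl, rfl, rfl, rfl⟩⟩
  comp h h' := ⟨fun a => h'.toFun (h.toFun a),
    ⟨fun a b => by rw [h.isHom.map_app, h'.isHom.map_app],
     by rw [h.isHom.map_B, h'.isHom.map_B], by rw [h.isHom.map_Cpos, h'.isHom.map_Cpos],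
     by rw [h.isHom.map_Cneg, h'.isHom.map_Cneg], by rw [h.isHom.map_I, h'.isHom.map_I]⟩⟩

end ExtBCAlgebra

namespace InternalOperad

open BCStructure

/-- `I_A(m) = {a^• ∘ B^m | a ∈ A}`. -/
def Op (A : Type u) [BCStructure A] (m : ℕ) : Type u :=
  {x : A // ∃ a : A, x = bullet a ⊚ bpow m}

section

variable {A : Type u} [BCStructure A] [IsExtensionalBC A]

theorem arity {m : ℕ} (x : Op A m) : Arity m 1 x.1 := exists_bullet_iff.1 x.2

/-- The action of `σ_i` (for `s = true`) or of its inverse (for `s = false`) on `I_A(m)`: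
precomposition with `B^i C⁺` or `B^i C⁻`. -/
def braidOne {m : ℕ} (s : Bool) (i : Fin (m - 1)) (x : Op A m) : Op A m :=
  ⟨(bpow i ⬝ C s) ⊚ x.1, exists_bullet_iff.2 ((arity_braid (by omega) s).cmp (arity x))⟩

/-- The action of `σ_i` as a permutation of `I_A(m)`. -/
def braidPerm {m : ℕ} (i : Fin (m - 1)) : Equiv.Perm (Op A m) where
  toFun := braidOne true i
  invFun := braidOne false i
  left_inv x := Subtype.ext (braid_inv i false x.1)
  right_inv x := Subtype.ext (braid_inv i true x.1)

/-- The right action of the braid group `B_m` on `I_A(m)` in which the generators `σ_i` act by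
`braidOne`. -/
def braidAct (A : Type u) [BCStructure A] [IsExtensionalBC A] (m : ℕ) :
    BraidGroup m →* (Equiv.Perm (Op A m))ᵐᵒᵖ :=
  BraidGroup.lift (fun i => .op (braidPerm i))
    (by
      intro i j h
      refine MulOpposite.unop_injective (Equiv.ext fun x => Subtype.ext ?_)
      change (bpow j ⬝ C true : A) ⊚ ((bpow i ⬝ C true) ⊚ x.1) =
        (bpow i ⬝ C true) ⊚ ((bpow j ⬝ C true) ⊚ x.1)
      rw [← cmp_assoc, ← cmp_assoc, braid_far h])
    (by
      intro i j h
      refine MulOpposite.unop_injective (Equiv.ext fun x => Subtype.ext ?_)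
      change (bpow i ⬝ C true : A) ⊚ ((bpow j ⬝ C true) ⊚ ((bpow i ⬝ C true) ⊚ x.1)) =
        (bpow j ⬝ C true) ⊚ ((bpow i ⬝ C true) ⊚ ((bpow j ⬝ C true) ⊚ x.1))
      have := congrArg (· ⊚ x.1) (braid_near (A := A) i true)
      simpa only [cmp_assoc, h] using this)

end

/-- The internal operad `I_A`: the identity is `I`, the application is `B`, and the composite
`g(f_1, …, f_n)` is `f_1 ∘ (B f_2) ∘ ⋯ ∘ (B^{n-1} f_n) ∘ g`. -/
def data (A : Type u) [BCStructure A] [IsExtensionalBC A] : OperadData.{u} where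
  Op := Op A
  one := ⟨I, exists_bullet_iff.2 (arity_I.add 1)⟩
  comp {n m k} g f h :=
    ⟨(List.ofFn fun i : Fin n => bpow (i : ℕ) ⬝ (f i).1).foldr BCStructure.cmp g.1,
      exists_bullet_iff.2 (by
        have := arity_foldr n k (fun i => (f i).1) g.1 1 0 (fun i => arity (f i)) (arity g)
        rw [h]
        simpa using this)⟩
  act {m} x s := (braidAct A m s).unop x
  app := ⟨B, exists_bullet_iff.2 arity_B⟩

theorem map_bpow {A A' : ExtBCAlgebra.{u}} (h : A ⟶ A') (m : ℕ) :
    h.toFun (bpow m) = bpow m := by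
  induction m with
  | zero => exact h.isHom.map_I
  | succ m ih =>
    change h.toFun (B ⬝ B ⬝ bpow m) = B ⬝ B ⬝ bpow m
    rw [h.isHom.map_app, h.isHom.map_app, h.isHom.map_B, ih]

/-- A homomorphism `h : A → A'` restricts to maps `I_A(m) → I_{A'}(m)`. -/
def map {A A' : ExtBCAlgebra.{u}} (h : A ⟶ A') (m : ℕ) (x : Op A.carrier m) : Op A'.carrier m :=
  ⟨h.toFun x.1, by
    obtain ⟨_, a, rfl⟩ := x
    refine ⟨h.toFun a, ?_⟩
    change h.toFun (B ⬝ (Cpos ⬝ I ⬝ a) ⬝ bpow m) = B ⬝ (Cpos ⬝ I ⬝ h.toFun a) ⬝ bpow m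
    simp only [h.isHom.map_app, h.isHom.map_B, h.isHom.map_Cpos, h.isHom.map_I, map_bpow]⟩

end InternalOperad

/-- The functor `A ↦ I_A`, given that `I_A` is a closed braided operad and that `A ↦ I_A` sends
homomorphisms to homomorphisms. -/
def internalOperadFunctor
    (hobj : ∀ A : ExtBCAlgebra.{u}, (InternalOperad.data A.carrier).IsClosedBraidedOperad)
    (hmap : ∀ {A A' : ExtBCAlgebra.{u}} (h : A ⟶ A'),
      OperadData.IsHom (InternalOperad.data A.carrier) (InternalOperad.data A'.carrier)
        (InternalOperad.map h)) :
    ExtBCAlgebra.{u} ⥤ ClosedBraidedOperad.{u} where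
  obj A := ⟨InternalOperad.data A.carrier, hobj A⟩
  map h := ⟨InternalOperad.map h, hmap h⟩

/-- The functor `P ↦ P(0)`, given that `P(0)` is an extensional `BC^±I`-algebra and that `P ↦ P(0)`
sends homomorphisms to homomorphisms. -/
noncomputable def zeroFunctor
    (hobj : ∀ P : ClosedBraidedOperad.{u}, @IsExtensionalBC (P.Op 0) P.zeroStructure)
    (hmap : ∀ {P Q : ClosedBraidedOperad.{u}} (φ : P ⟶ Q),
      IsBCHom P.zeroStructure Q.zeroStructure (φ.toFun 0)) :
    ClosedBraidedOperad.{u} ⥤ ExtBCAlgebra.{u} where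
  obj P := @ExtBCAlgebra.mk (P.Op 0) P.zeroStructure (hobj P)
  map φ := ⟨φ.toFun 0, hmap φ⟩

/-! Under composition an extensional algebra is a monoid with unit `I`, and an element of arity `m →
n` behaves like a diagram with `m` inputs and `n` outputs: a factor `B^m y` on its left moves past
it and becomes `B^n y` on its right. The operators of `I_A(m)` are the elements of arity `m → 1`, a
tuple of operators is a juxtaposition `f_1 ∘ (B f_2) ∘ ⋯`, and `σ_i` acts by left composition with a
shifted `C⁺`.

Moving factors past arities gives the interchange law `tensor_mul`, hence associativity and
equivariance for braids on the inner operators. Equivariance for the outer braid is the substantial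
law. It rests on the naturality `mul_crossElt` of a single crossing; as every operator is `a^• ∘
B^m`, this splits into the case of a constant `a^•` and the case of `B`, where it is the axiom `bc`.
The lemma `tensorFin_mul_braidElt` extends it to all braids. For closedness, `app(-, id)` is right
composition with `B`; it takes `a^• ∘ B^m` to `a^• ∘ B^(m+1)`, and evaluation at `I` recovers `a`
from either.

For a closed braided operad `P`, application is extended to operators of all arities. Uniqueness in
closedness says that `x` is determined by `app(x, id)` (`unit_ext`), so an axiom for `P(0)` can be
tested after supplying identities as arguments. There `B` rebrackets, `C^±` exchanges two arguments
up to a crossing of blocks (`C_apply`), and the axioms become identities between bracketings and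
between braids.

The unit `a ↦ a^•` is a bijection from `A` to `I_A(0)`; that it preserves `B` and `C^±` amounts to
these having arities `2 → 1` and `2 → 2`. The counit sends `a^• ∘ B^m` to `app(… app(a, id) …, id)`;
it preserves composites because each factor of a juxtaposition consumes its own block of identities
(`foldl_foldr_cmp`). Both triangle identities come down to recovering `a` from `a^• ∘ B^m` by
evaluation at `I`. -/

/-- Induction over words in the generators and their inverses. -/
theorem BraidGroup.induction {n : ℕ} {p : BraidGroup n → Prop} (one : p 1)
    (gen : ∀ i : ℕ, i + 1 < n → p (σ n i)) (inv : ∀ i : ℕ, i + 1 < n → p (σ n i) → p (σ n i)⁻¹)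
    (mul : ∀ s t, p s → p t → p (s * t)) (s : BraidGroup n) : p s := by
  obtain ⟨w, rfl⟩ := PresentedGroup.mk_surjective _ s
  induction w using FreeGroup.induction_on with
  | C1 => exact one
  | of i =>
    have := gen i (by omega)
    rwa [σ_of] at this
  | inv_of i _ =>
    have := inv i (by omega) (gen i (by omega))
    rwa [σ_of] at this
  | mul x y hx hy => rw [map_mul]; exact mul _ _ hx hy

/-! ### Naturality of the crossing in the monoid of an extensional algebra -/

namespace BCStructure

section Monoid

open IsExtensionalBC BraidGroup

variable {A : Type u} [BCStructure A] [IsExtensionalBC A]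

/-- The elements of an extensional algebra form a monoid under composition. -/
abbrev cmpMonoid : Monoid A where
  mul := cmp
  one := I
  mul_assoc := cmp_assoc
  one_mul := I_cmp
  mul_one := cmp_I

attribute [local instance] cmpMonoid

theorem mul_eq_cmp (x y : A) : x * y = x ⊚ y := rfl

theorem bpow_app_mul (m : ℕ) (x y : A) : bpow m ⬝ (x * y) = (bpow m ⬝ x) * (bpow m ⬝ y) :=
  bpow_app_cmp m x y

theorem bpow_app_one (m : ℕ) : bpow m ⬝ (1 : A) = 1 := bpow_app_I m

theorem bpow_one_app (x : A) : bpow 1 ⬝ x = B ⬝ x := by rw [bpow_succ_app, bpow_zero_app]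

theorem Arity.exch_add {m n : ℕ} {x : A} (h : Arity m n x) (d : ℕ) (y : A) :
    (bpow (m + d) ⬝ y) * x = x * (bpow (n + d) ⬝ y) :=
  (h.add d).exch y

/-- The element by which the generator `σ_i` acts. -/
def crossElt (A : Type u) [BCStructure A] (i : ℕ) : A := bpow i ⬝ C true

theorem bpow_app_crossElt (r i : ℕ) : bpow r ⬝ crossElt A i = crossElt A (r + i) :=
  (bpow_add_app _ _ _).symm

/-- The value by which the braid `strandCross n p b` acts. -/
def strandElt (A : Type u) [BCStructure A] [IsExtensionalBC A] (p : ℕ) : ℕ → A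
  | 0 => 1
  | b + 1 => strandElt A p b * crossElt A (p + b)

/-- The value by which the braid `blockCross n p a b` acts. -/
def blockElt (A : Type u) [BCStructure A] [IsExtensionalBC A] (p : ℕ) : ℕ → ℕ → A
  | 0, _ => 1
  | a + 1, b => strandElt A (p + a) b * blockElt A p a b

theorem strandElt_succ (p b : ℕ) :
    strandElt A p (b + 1) = strandElt A p b * crossElt A (p + b) := rfl

theorem blockElt_succ (p a b : ℕ) :
    blockElt A p (a + 1) b = strandElt A (p + a) b * blockElt A p a b := rfl

theorem bpow_app_strandElt (r p b : ℕ) :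
    bpow r ⬝ strandElt A p b = strandElt A (r + p) b := by
  induction b with
  | zero => exact bpow_app_one r
  | succ b ih => rw [strandElt, bpow_app_mul, ih, bpow_app_crossElt, strandElt, add_assoc]

theorem bpow_app_blockElt (r p a b : ℕ) :
    bpow r ⬝ blockElt A p a b = blockElt A (r + p) a b := by
  induction a with
  | zero => exact bpow_app_one r
  | succ a ih => rw [blockElt, bpow_app_mul, ih, bpow_app_strandElt, blockElt, add_assoc]

theorem arity_crossElt {m i : ℕ} (h : i + 1 < m) : Arity m m (crossElt A i) := arity_braid h true

/-- Elements `B^(i+2) y` commute with the crossing in position `i`. -/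
theorem crossElt_comm (i d : ℕ) (y : A) :
    (bpow (i + 2 + d) ⬝ y) * crossElt A i = crossElt A i * (bpow (i + 2 + d) ⬝ y) :=
  (arity_crossElt (m := i + 2) (by omega)).exch_add d y

theorem crossElt_mul_crossElt (i d : ℕ) :
    crossElt A (i + 2 + d) * crossElt A i = crossElt A i * crossElt A (i + 2 + d) :=
  crossElt_comm i d (C true)

theorem B_mul_crossElt (i : ℕ) : B * crossElt A (i + 1) = crossElt A (i + 2) * B := by
  have := (arity_B (A := A)).exch_add i (C true)
  rw [add_comm 2, add_comm 1] at this
  exact this.symm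

/-- This is the axiom `bc`: a strand that crosses the output of `B` may instead cross its two
inputs. -/
theorem BB_mul_crossElt_zero :
    (B ⬝ B : A) * crossElt A 0 = crossElt A 0 * crossElt A 1 * (B : A) := by
  have := bc (A := A) true
  simp only [crossElt, bpow_succ_app, bpow_zero_app, mul_eq_cmp, cmp_assoc]
  exact this

/-- The mirror image of `bc`, with `B` on the other side of the crossing strand; it is `bc'` shifted
by `p` positions. -/
theorem bpow_app_B_mul_crossElt (p : ℕ) :
    (bpow p ⬝ B : A) * crossElt A p =
      crossElt A (p + 1) * crossElt A p * (bpow (p + 1) ⬝ B) := by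
  have := congrArg (bpow p ⬝ ·) (bc' (A := A) true)
  simp only [bpow_app_cmp] at this
  simp only [crossElt, bpow_succ_app, mul_eq_cmp, cmp_assoc]
  simpa only [← bpow_succ_app, bpow_succ', cmp_app] using this

theorem bullet_mul_crossElt (a : A) (i : ℕ) :
    bullet a * crossElt A (i + 1) = crossElt A i * bullet a := by
  rw [crossElt, bpow_succ_app]
  exact (cmp_bullet _ a).symm

theorem B_bullet_mul_crossElt (a : A) : (B ⬝ bullet a) * crossElt A 0 = bullet a := by
  -- `L_bullet` holds for both signs; the negative one is chosen because it cancels against the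
  -- crossing.
  rw [crossElt, bpow_zero_app, mul_eq_cmp, L_bullet false, cmp_assoc]
  have := cox_one (A := A) false
  simp only [Bool.not_false] at this
  rw [this, cmp_I]

theorem BB_mul_strandElt (b : ℕ) :
    (B ⬝ B : A) * strandElt A 0 (b + 1) = strandElt A 0 (b + 2) * B := by
  induction b with
  | zero =>
    simp only [strandElt, one_mul, BB_mul_crossElt_zero, zero_add]
  | succ b ih =>
    rw [strandElt, ← mul_assoc, ih, mul_assoc, zero_add, B_mul_crossElt, ← mul_assoc,
      strandElt_succ 0 (b + 2), zero_add]

/-- `B^b` merges `b + 1` strands into one, so iterating `bc` replaces the one crossing by `b + 1`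
crossings. -/
theorem B_bpow_mul_crossElt (b : ℕ) :
    (B ⬝ bpow b : A) * crossElt A 0 = strandElt A 0 (b + 1) * bpow b := by
  induction b with
  | zero =>
    simp only [strandElt, one_mul, bpow, lam, zero_add]
    exact (I_cmp _).trans (cmp_I _).symm
  | succ b ih =>
    rw [bpow, L_cmp, ← mul_eq_cmp, mul_assoc, ih, ← mul_assoc, BB_mul_strandElt, mul_assoc]
    rfl

/-- A constant has no inputs, so the last crossing disappears and the earlier ones slide past it. -/
theorem B_bullet_mul_strandElt (a : A) (b : ℕ) :
    (B ⬝ bullet a) * strandElt A 0 (b + 1) = strandElt A 0 b * bullet a := by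
  induction b with
  | zero => simp only [strandElt, one_mul, zero_add, B_bullet_mul_crossElt]
  | succ b ih =>
    rw [strandElt, ← mul_assoc, ih, mul_assoc, zero_add, bullet_mul_crossElt, ← mul_assoc,
      strandElt_succ 0 b, zero_add]

/-- First half of naturality: one strand crosses an operator. Writing `h = a^• ∘ B^b`, the power of
`B` produces `b + 1` crossings and the constant absorbs one of them. -/
theorem B_app_mul_crossElt {b : ℕ} {h : A} (hh : Arity b 1 h) :
    (B ⬝ h) * crossElt A 0 = strandElt A 0 b * h := by
  obtain ⟨a, rfl⟩ := exists_bullet_iff.2 hh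
  rw [L_cmp, ← mul_eq_cmp, ← mul_eq_cmp, mul_assoc, B_bpow_mul_crossElt, ← mul_assoc,
    B_bullet_mul_strandElt, mul_assoc]

theorem crossElt_mul_strandElt (p b d : ℕ) :
    crossElt A (p + b + 1 + d) * strandElt A p b = strandElt A p b * crossElt A (p + b + 1 + d) := by
  induction b generalizing d with
  | zero => simp [strandElt]
  | succ b ih =>
    have h1 := ih (d + 1)
    rw [show p + b + 1 + (d + 1) = p + (b + 1) + 1 + d by omega] at h1
    have h2 := crossElt_mul_crossElt (A := A) (p + b) d
    rw [show p + b + 2 + d = p + (b + 1) + 1 + d by omega] at h2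
    rw [strandElt, ← mul_assoc, h1, mul_assoc, h2, mul_assoc]

theorem B_mul_strandElt_zero (b : ℕ) :
    B * strandElt A 0 b = strandElt A 1 b * strandElt A 0 b * (bpow b ⬝ B) := by
  induction b with
  | zero => simp only [strandElt, one_mul, mul_one, bpow_zero_app]
  | succ b ih =>
    have h := crossElt_mul_strandElt (A := A) 0 b 0
    simp only [zero_add, add_zero] at h
    simp only [strandElt, zero_add]
    rw [← mul_assoc, ih, mul_assoc, bpow_app_B_mul_crossElt, add_comm 1 b]
    simp only [← mul_assoc]
    rw [mul_assoc (strandElt A 1 b) (strandElt A 0 b), ← h, ← mul_assoc]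

theorem B_mul_strandElt (p b : ℕ) :
    B * strandElt A (p + 1) b = strandElt A (p + 2) b * B := by
  induction b with
  | zero => simp only [strandElt, one_mul, mul_one]
  | succ b ih =>
    rw [strandElt, ← mul_assoc, ih, mul_assoc, show p + 1 + b = p + b + 1 by omega,
      B_mul_crossElt, ← mul_assoc, strandElt, show p + 2 + b = p + b + 2 by omega]

theorem B_mul_blockElt (a b : ℕ) :
    B * blockElt A 0 (a + 1) b = blockElt A 0 (a + 2) b * (bpow b ⬝ B) := by
  induction a with
  | zero => simp only [blockElt, mul_one, zero_add, B_mul_strandElt_zero]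
  | succ a ih =>
    rw [blockElt, ← mul_assoc, zero_add, B_mul_strandElt, mul_assoc, ih, blockElt_succ 0 (a + 1 + 1) b,
      mul_assoc, zero_add]

theorem bpow_mul_strandElt (a b : ℕ) :
    bpow a * strandElt A 0 b = blockElt A 0 (a + 1) b * (bpow b ⬝ bpow a) := by
  induction a with
  | zero =>
    simp only [blockElt, mul_one, zero_add, bpow, bpow_app_I]
    exact (I_cmp _).trans (cmp_I _).symm
  | succ a ih =>
    rw [bpow, ← mul_eq_cmp, mul_assoc, ih, ← mul_assoc, B_mul_blockElt, mul_assoc, bpow_app_mul]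

theorem bullet_mul_strandElt_zero (a : A) (b : ℕ) :
    bullet a * strandElt A 0 b = bpow b ⬝ bullet a := by
  induction b with
  | zero => rw [strandElt, mul_one, bpow_zero_app]
  | succ b ih =>
    rw [strandElt, ← mul_assoc, ih, zero_add, crossElt, ← bpow_app_mul, mul_eq_cmp, ← L_bullet,
      bpow_succ', cmp_app]

theorem bullet_mul_strandElt (a : A) (p b : ℕ) :
    bullet a * strandElt A (p + 1) b = strandElt A p b * bullet a := by
  have := cmp_bullet (strandElt A p b) a
  rw [← bpow_one_app, bpow_app_strandElt, add_comm 1] at this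
  exact this.symm

theorem bullet_mul_blockElt (x : A) (a b : ℕ) :
    bullet x * blockElt A 0 (a + 1) b = blockElt A 0 a b * (bpow b ⬝ bullet x) := by
  induction a with
  | zero => simp only [blockElt, mul_one, one_mul, zero_add, bullet_mul_strandElt_zero]
  | succ a ih =>
    rw [blockElt, ← mul_assoc, zero_add, bullet_mul_strandElt, mul_assoc, ih,
      blockElt_succ 0 a b, mul_assoc, zero_add]

/-- Second half of naturality: an operator crosses `b` parallel strands. The decomposition `g = x^•
∘ B^a` again separates the powers of `B` from the constant, which absorbs one row of crossings. -/
theorem mul_strandElt {a b : ℕ} {g : A} (hg : Arity a 1 g) :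
    g * strandElt A 0 b = blockElt A 0 a b * (bpow b ⬝ g) := by
  obtain ⟨x, rfl⟩ := exists_bullet_iff.2 hg
  rw [← mul_eq_cmp, mul_assoc, bpow_mul_strandElt, ← mul_assoc, bullet_mul_blockElt, mul_assoc,
    bpow_app_mul]

/-- Naturality of the crossing. -/
theorem mul_crossElt {a b : ℕ} {g h : A} (hg : Arity a 1 g) (hh : Arity b 1 h) :
    g * (B ⬝ h) * crossElt A 0 = blockElt A 0 a b * (h * (B ⬝ g)) := by
  have e := hh.exch g
  rw [bpow_succ_app, bpow_zero_app] at e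
  -- First `h` is pulled through the crossing, which leaves a single strand crossing the inputs of
  -- `h`; then `g` is pulled along that strand. The final exchange `e` is the arity of `h`.
  rw [mul_assoc, B_app_mul_crossElt hh, ← mul_assoc, mul_strandElt hg, mul_assoc]
  exact congrArg _ e

end Monoid

end BCStructure

/-! ### Braids as invertible elements -/

namespace BCStructure

section BraidElt

open IsExtensionalBC BraidGroup

variable {A : Type u} [BCStructure A] [IsExtensionalBC A]

attribute [local instance] cmpMonoid

/-- The crossing in position `i` is invertible under composition. -/
def crossUnit (A : Type u) [BCStructure A] [IsExtensionalBC A] (i : ℕ) : Aˣ where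
  val := crossElt A i
  inv := bpow i ⬝ C false
  val_inv := (cmp_I _).symm.trans ((cmp_assoc _ _ _).trans (braid_inv i true I))
  inv_val := (cmp_I _).symm.trans ((cmp_assoc _ _ _).trans (braid_inv i false I))

/-- The invertible elements by which braids act. -/
def braidUnit (A : Type u) [BCStructure A] [IsExtensionalBC A] (m : ℕ) :
    BraidGroup m →* (Aˣ)ᵐᵒᵖ :=
  -- The opposite group is needed because a right action is realised by left composition.
  BraidGroup.lift (fun i => .op (crossUnit A i))
    (fun _ _ h => MulOpposite.unop_injective (Units.ext (braid_far h true).symm))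
    (fun i j h => MulOpposite.unop_injective (Units.ext (by
      have := braid_near (A := A) i true
      rw [h] at this
      exact this)))

/-- The element by which the braid `s` acts. -/
def braidElt (A : Type u) [BCStructure A] [IsExtensionalBC A] {m : ℕ} (s : BraidGroup m) : A :=
  ((braidUnit A m s).unop : Aˣ)

theorem braidElt_one (m : ℕ) : braidElt A (1 : BraidGroup m) = 1 := by
  rw [braidElt, map_one]; rfl

theorem braidElt_mul {m : ℕ} (s t : BraidGroup m) :
    braidElt A (s * t) = braidElt A t * braidElt A s := by
  rw [braidElt, map_mul]; rfl

theorem braidElt_σ {m i : ℕ} (h : i + 1 < m) : braidElt A (σ m i) = crossElt A i := by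
  rw [braidElt, σ, dif_pos (by omega), braidUnit, lift_of]; rfl

theorem braidElt_σ_inv {m i : ℕ} (h : i + 1 < m) :
    braidElt A (σ m i)⁻¹ = bpow i ⬝ C false := by
  rw [braidElt, map_inv, σ, dif_pos (by omega), braidUnit, lift_of]; rfl

theorem braidElt_mul_inv {m : ℕ} (s : BraidGroup m) :
    braidElt A s * braidElt A s⁻¹ = 1 := by
  rw [← braidElt_mul, inv_mul_cancel, braidElt_one]

theorem arity_one (m : ℕ) : Arity m m (1 : A) := by
  have := (arity_I (A := A)).add m
  rwa [zero_add] at this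

theorem arity_braidElt {m : ℕ} (s : BraidGroup m) : Arity m m (braidElt A s) := by
  induction s using BraidGroup.induction with
  | one => rw [braidElt_one]; exact arity_one m
  | gen i hi => rw [braidElt_σ hi]; exact arity_crossElt hi
  | inv i hi _ => rw [braidElt_σ_inv hi]; exact arity_braid hi false
  | mul s t hs ht => rw [braidElt_mul]; exact ht.cmp hs

theorem braidElt_place {j m p : ℕ} (h : p + j ≤ m) (s : BraidGroup j) :
    braidElt A (place p h s) = bpow p ⬝ braidElt A s := by
  have hσ : ∀ i, i + 1 < j → place p h (σ j i) = σ m (p + i) := by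
    intro i hi
    rw [σ, dif_pos (by omega), place, lift_of]
  induction s using BraidGroup.induction with
  | one => rw [map_one, braidElt_one, braidElt_one, bpow_app_one]
  | gen i hi => rw [hσ i hi, braidElt_σ (by omega), braidElt_σ hi, bpow_app_crossElt]
  | inv i hi _ =>
    rw [map_inv, hσ i hi, braidElt_σ_inv (by omega), braidElt_σ_inv hi, ← bpow_add_app]
  | mul s t hs ht => rw [map_mul, braidElt_mul, hs, ht, braidElt_mul, bpow_app_mul]

theorem braidElt_strandCross {m p b : ℕ} (h : p + b < m) :
    braidElt A (strandCross m p b) = strandElt A p b := by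
  induction b with
  | zero => exact braidElt_one m
  | succ b ih =>
    rw [strandCross, braidElt_mul, ih (by omega), braidElt_σ (by omega), strandElt]

theorem braidElt_blockCross {m p a b : ℕ} (h : p + a + b ≤ m) :
    braidElt A (blockCross m p a b) = blockElt A p a b := by
  induction a with
  | zero => exact braidElt_one m
  | succ a ih =>
    rw [blockCross, braidElt_mul, ih (by omega), braidElt_strandCross (by omega), blockElt]

end BraidElt

/-! ### Juxtaposition of operators and the interchange law -/

section SeqProd

open IsExtensionalBC BraidGroup

variable {A : Type u} [BCStructure A] [IsExtensionalBC A]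

attribute [local instance] cmpMonoid

/-- The composite `F_0 ∘ F_1 ∘ ⋯ ∘ F_{n-1}`. -/
def seqProd (F : ℕ → A) : ℕ → A
  | 0 => 1
  | n + 1 => seqProd F n * F n

theorem seqProd_congr {F G : ℕ → A} {n : ℕ} (h : ∀ i < n, F i = G i) :
    seqProd F n = seqProd G n := by
  induction n with
  | zero => rfl
  | succ n ih => rw [seqProd, seqProd, ih (fun i hi => h i (by omega)), h n (by omega)]

theorem seqProd_add (F : ℕ → A) (m n : ℕ) :
    seqProd F (m + n) = seqProd F m * seqProd (fun i => F (m + i)) n := by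
  induction n with
  | zero => exact (mul_one _).symm
  | succ n ih => rw [← add_assoc, seqProd, ih, seqProd, mul_assoc]

theorem bpow_app_seqProd (p : ℕ) (F : ℕ → A) (n : ℕ) :
    bpow p ⬝ seqProd F n = seqProd (fun i => bpow p ⬝ F i) n := by
  induction n with
  | zero => exact bpow_app_one p
  | succ n ih => rw [seqProd, bpow_app_mul, ih, seqProd]

theorem foldr_ofFn {n : ℕ} {f : Fin n → A} {F : ℕ → A} (h : ∀ i : Fin n, f i = F i) (g : A) :
    (List.ofFn f).foldr BCStructure.cmp g = seqProd F n * g := by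
  induction n generalizing g with
  | zero => exact (one_mul g).symm
  | succ n ih =>
    rw [List.ofFn_succ', List.concat_eq_append, List.foldr_append, ih fun i => h i.castSucc,
      seqProd, mul_assoc, List.foldr_cons, List.foldr_nil, h]
    rfl

/-- The total width of the first `n` blocks. -/
def width (k : ℕ → ℕ) (n : ℕ) : ℕ := ∑ i ∈ Finset.range n, k i

theorem width_succ (k : ℕ → ℕ) (n : ℕ) : width k (n + 1) = width k n + k n :=
  Finset.sum_range_succ _ _

theorem seqProd_width (F : ℕ → A) (k : ℕ → ℕ) (n : ℕ) :
    seqProd F (width k n) = seqProd (fun i => seqProd (fun j => F (width k i + j)) (k i)) n := by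
  induction n with
  | zero => rfl
  | succ n ih => rw [width_succ, seqProd_add, ih, seqProd]

/-- The juxtaposition `G_0 ∘ (B G_1) ∘ ⋯ ∘ (B^{n-1} G_{n-1})`. -/
def tensor (G : ℕ → A) (n : ℕ) : A := seqProd (fun i => bpow i ⬝ G i) n

theorem tensor_succ (G : ℕ → A) (n : ℕ) : tensor G (n + 1) = tensor G n * (bpow n ⬝ G n) := rfl

theorem tensor_congr {F G : ℕ → A} {n : ℕ} (h : ∀ i < n, F i = G i) : tensor F n = tensor G n :=
  seqProd_congr fun i hi => by rw [h i hi]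

/-- The earlier factors ignore the `k n` new inputs, and the new factor is shifted by the `n`
outputs already present. -/
theorem arity_tensor {k : ℕ → ℕ} {G : ℕ → A} {n : ℕ} (h : ∀ i < n, Arity (k i) 1 (G i)) :
    Arity (width k n) n (tensor G n) := by
  induction n with
  | zero => exact arity_I
  | succ n ih =>
    have h1 := (ih fun i hi => h i (by omega)).add (k n)
    have h2 := (h n (by omega)).bpow_app n
    rw [add_comm (k n), add_comm 1] at h2
    rw [width_succ]
    exact h1.cmp h2

/-- Interchange law: `F n` is moved in front of the first `n` factors, whose arity turns its shift
`n` into the total width of their inputs. -/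
theorem tensor_mul {k : ℕ → ℕ} (F : ℕ → A) {G : ℕ → A} {n : ℕ}
    (h : ∀ i < n, Arity (k i) 1 (G i)) :
    tensor (fun i => F i * G i) n = seqProd (fun i => bpow (width k i) ⬝ F i) n * tensor G n := by
  induction n with
  | zero => exact (mul_one _).symm
  | succ n ih =>
    have h1 := (arity_tensor fun i (hi : i < n) => h i (by omega)).exch (F n)
    rw [← mul_eq_cmp, ← mul_eq_cmp] at h1
    rw [tensor_succ, ih fun i hi => h i (by omega), bpow_app_mul, seqProd, tensor_succ, mul_assoc,
      ← mul_assoc (tensor G n), ← h1]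
    simp only [mul_assoc]

/-- Naturality of the crossing inside a juxtaposition. The `d` factors after the crossed pair
commute with the crossing, so only the factors before it have to be passed. -/
theorem tensor_swap_mul_crossElt {k : ℕ → ℕ} {G G' : ℕ → A} {i : ℕ} (d : ℕ)
    (h : ∀ l < i + 2, Arity (k l) 1 (G l)) (h0 : G' i = G (i + 1)) (h1 : G' (i + 1) = G i)
    (h2 : ∀ l, l ≠ i → l ≠ i + 1 → G' l = G l) :
    tensor G (i + 2 + d) * crossElt A i =
      blockElt A (width k i) (k i) (k (i + 1)) * tensor G' (i + 2 + d) := by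
  induction d with
  | zero =>
    have e : tensor G' i = tensor G i := tensor_congr fun l hl => h2 l (by omega) (by omega)
    have h3 := congrArg (bpow i ⬝ ·) (mul_crossElt (h i (by omega)) (h (i + 1) (by omega)))
    simp only [bpow_app_mul, bpow_app_crossElt, bpow_app_blockElt, add_zero] at h3
    simp only [← cmp_app, ← bpow_succ'] at h3
    -- The factors before the pair have arity `width k i → i`, so moving the block crossing to the
    -- front changes its position from `i` to `width k i`.
    have h4 := (arity_tensor fun l (hl : l < i) => h l (by omega)).exch
      (blockElt A 0 (k i) (k (i + 1)))
    simp only [bpow_app_blockElt, ← mul_eq_cmp, add_zero] at h4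
    simp only [add_zero, tensor_succ, h0, h1, e, mul_assoc] at h3 ⊢
    rw [h3, ← mul_assoc, ← h4, mul_assoc]
  | succ d ih =>
    rw [← add_assoc, tensor_succ, mul_assoc, crossElt_comm, ← mul_assoc, ih, tensor_succ,
      mul_assoc, h2 _ (by omega) (by omega)]

end SeqProd

end BCStructure

/-- Extension of a finite sequence by a default value. -/
def extendFin {α : Type*} {n : ℕ} (d : α) (f : Fin n → α) (i : ℕ) : α :=
  if h : i < n then f ⟨i, h⟩ else d

theorem extendFin_of_lt {α : Type*} {n : ℕ} (d : α) (f : Fin n → α) {i : ℕ} (h : i < n) :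
    extendFin d f i = f ⟨i, h⟩ := dif_pos h

theorem extendFin_val {α : Type*} {n : ℕ} (d : α) (f : Fin n → α) (i : Fin n) :
    extendFin d f i = f i := dif_pos i.2

/-! ### Cabling and direct sums as elements of the algebra -/

namespace BCStructure

open IsExtensionalBC BraidGroup

theorem offset_eq_width {n : ℕ} (k : Fin n → ℕ) {i : ℕ} (h : i ≤ n) :
    offset k i = width (extendFin 0 k) i := by
  induction i with
  | zero => simp [offset, width]
  | succ i ih =>
    rw [offset_succ k ⟨i, h⟩, width_succ, extendFin_of_lt 0 k h]
    simp only [ih (by omega)]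

theorem sum_eq_width {n : ℕ} (k : Fin n → ℕ) : ∑ i, k i = width (extendFin 0 k) n := by
  rw [width, Finset.sum_range]
  exact Finset.sum_congr rfl fun i _ => (extendFin_val 0 k i).symm

theorem finSigmaFinEquiv_val {n : ℕ} (k : Fin n → ℕ) (i : Fin n) (j : Fin (k i)) :
    (finSigmaFinEquiv ⟨i, j⟩ : ℕ) = width (extendFin 0 k) i + j := by
  rw [finSigmaFinEquiv_apply, width, Finset.sum_range]
  congr 1
  exact Finset.sum_congr rfl fun l _ => (extendFin_of_lt 0 k (by omega)).symm

variable {A : Type u} [BCStructure A]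

theorem arity_extendFin {n : ℕ} {k : Fin n → ℕ} {G : Fin n → A} (h : ∀ i, Arity (k i) 1 (G i)) :
    ∀ i < n, Arity (extendFin 0 k i) 1 (extendFin I G i) := by
  intro i hi
  rw [extendFin_of_lt _ _ hi, extendFin_of_lt _ _ hi]
  exact h _

variable [IsExtensionalBC A]

attribute [local instance] cmpMonoid

/-- `tensor` for a finite sequence. -/
def tensorFin {n : ℕ} (G : Fin n → A) : A := tensor (extendFin I G) n

theorem foldr_tensorFin {n : ℕ} (G : Fin n → A) (g : A) :
    (List.ofFn fun i : Fin n => bpow (i : ℕ) ⬝ G i).foldr BCStructure.cmp g = tensorFin G * g :=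
  foldr_ofFn (F := fun i => bpow i ⬝ extendFin I G i) (fun i => by simp only [extendFin_val]) g

theorem tensorFin_mul {n : ℕ} {k : Fin n → ℕ} (F : Fin n → A) {G : Fin n → A}
    (h : ∀ i, Arity (k i) 1 (G i)) :
    tensorFin (fun i => F i * G i) =
      seqProd (fun i => bpow (width (extendFin 0 k) i) ⬝ extendFin I F i) n * tensorFin G := by
  rw [tensorFin, tensorFin, ← tensor_mul _ (arity_extendFin h)]
  exact tensor_congr fun i hi => by simp only [extendFin_of_lt _ _ hi]

/-- Position `(i, j)` of the flattened sequence carries the shift `width i + j`, so the `i`-th block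
is an inner juxtaposition shifted by `width i`. -/
theorem tensorFin_sigma {n N : ℕ} {k : Fin n → ℕ} (hN : N = ∑ i, k i)
    (f : ∀ i, Fin (k i) → A) (F : Fin N → A)
    (hF : ∀ i j, F (Fin.cast hN.symm (finSigmaFinEquiv ⟨i, j⟩)) = f i j) :
    tensorFin F =
      seqProd (fun i => bpow (width (extendFin 0 k) i) ⬝
        extendFin I (fun i => tensorFin (f i)) i) n := by
  obtain rfl : N = width (extendFin 0 k) n := hN.trans (sum_eq_width k)
  rw [tensorFin, tensor, seqProd_width]
  refine seqProd_congr fun i hi => ?_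
  rw [extendFin_of_lt 0 k hi, extendFin_of_lt _ _ hi, tensorFin, tensor, bpow_app_seqProd]
  refine seqProd_congr fun j hj => ?_
  have h1 := finSigmaFinEquiv_val k ⟨i, hi⟩ ⟨j, hj⟩
  have h2 := extendFin_val I F (Fin.cast hN.symm (finSigmaFinEquiv ⟨⟨i, hi⟩, ⟨j, hj⟩⟩))
  rw [hF, Fin.val_cast, h1] at h2
  rw [← bpow_add_app, h2, extendFin_of_lt _ _ hj]

/-- A braid can be moved past a juxtaposition: it is cabled, and it permutes the factors. -/
theorem tensorFin_mul_braidElt {k : ℕ} (s : BraidGroup k) :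
    ∀ {w : Fin k → ℕ} {m : ℕ} (h : m = ∑ i, w i) {G : Fin k → A},
      (∀ i, Arity (w i) 1 (G i)) → tensorFin G * braidElt A s =
        braidElt A (cable s w h) * tensorFin (fun i => G ((perm s)⁻¹ i)) := by
  induction s using BraidGroup.induction with
  | one =>
    intro w m h G _
    rw [cable_one, braidElt_one, braidElt_one, map_one, mul_one, one_mul]
    rfl
  | gen i hi =>
    intro w m h G hG
    obtain ⟨d, rfl⟩ : ∃ d, k = i + 2 + d := ⟨k - (i + 2), by omega⟩
    have hp : (perm (σ (i + 2 + d) i))⁻¹ = adjSwap ⟨i, by omega⟩ := by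
      rw [σ, dif_pos (by omega), perm, lift_of, adjSwap_inv]
    have h1 := offset_succ w ⟨i, by omega⟩
    have h2 := offset_succ w ⟨i + 1, hi⟩
    have h3 := offset_le w (i + 1 + 1)
    simp only at h1 h2
    rw [cable_σ hi, braidElt_σ hi, hp, braidElt_blockCross (by omega), offset_eq_width w (by omega)]
    have := tensor_swap_mul_crossElt (k := extendFin 0 w) (G := extendFin I G)
      (G' := extendFin I fun l => G (adjSwap ⟨i, by omega⟩ l)) (i := i) d
      (fun l hl => arity_extendFin hG l (by omega)) ?_ ?_ ?_
    · rwa [extendFin_of_lt 0 w (by omega : i < _), extendFin_of_lt 0 w hi] at this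
    · rw [extendFin_of_lt _ _ (by omega), extendFin_of_lt _ _ hi]
      exact congrArg G (Fin.ext (by rw [adjSwap_val]; simp))
    · rw [extendFin_of_lt _ _ hi, extendFin_of_lt _ _ (by omega)]
      exact congrArg G (Fin.ext (by rw [adjSwap_val]; simp))
    · intro l h1 h2
      by_cases hl : l < i + 2 + d
      · rw [extendFin_of_lt _ _ hl, extendFin_of_lt _ _ hl]
        exact congrArg G (Fin.ext (by rw [adjSwap_val]; simp [h1, h2]))
      · rw [extendFin, extendFin, dif_neg hl, dif_neg hl]
  | inv i hi ih =>
    -- The statement for `s⁻¹` follows from the one for `s` with widths and factors permuted by `s`,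
    -- multiplied on both sides by inverse braid elements. This is why the induction quantifies over
    -- widths and factors.
    intro w m h G hG
    set s := σ k i
    have h1 := ih (w := w ∘ perm s) (Cabling.sum_comp _ h) (G := G ∘ perm s) (fun i => hG _)
    have h2 : cable s (w ∘ perm s) (Cabling.sum_comp _ h) * cable s⁻¹ w h = 1 := by
      have := cable_mul s s⁻¹ w h
      simp only [mul_inv_cancel, cable_one, map_inv, inv_inv] at this
      exact this.symm
    have h3 := congrArg (braidElt A) h2
    rw [braidElt_mul, braidElt_one] at h3
    simp only [Function.comp_apply, ← Equiv.Perm.mul_apply, mul_inv_cancel, Equiv.Perm.one_apply] at h1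
    rw [map_inv, inv_inv, ← one_mul (tensorFin G), ← h3, mul_assoc, mul_assoc,
      ← mul_assoc (braidElt A (cable s _ _)), ← h1, mul_assoc, braidElt_mul_inv, mul_one]
    rfl
  | mul s t hs ht =>
    intro w m h G hG
    rw [cable_mul, braidElt_mul, braidElt_mul, ← mul_assoc, ht h hG, mul_assoc,
      hs (w := w ∘ ⇑(perm t)⁻¹) (Cabling.sum_comp _ h) (fun i => hG _), ← mul_assoc, map_mul,
      mul_inv_rev]
    rfl

theorem seqProd_commute {F : ℕ → A} {x : A} {n : ℕ} (h : ∀ i < n, F i * x = x * F i) :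
    seqProd F n * x = x * seqProd F n := by
  induction n with
  | zero => exact (one_mul x).trans (mul_one x).symm
  | succ n ih =>
    rw [seqProd, mul_assoc, h n (by omega), ← mul_assoc, ih fun i hi => h i (by omega), mul_assoc]

theorem width_mono (k : ℕ → ℕ) {i j : ℕ} (h : i ≤ j) : width k i ≤ width k j :=
  Finset.sum_le_sum_of_subset (Finset.range_subset_range.2 h)

/-- Passing to elements reverses a product of braids; pairwise commutation restores the order. -/
theorem braidElt_prod_ofFn {m : ℕ} {F : ℕ → A} {n : ℕ} (t : Fin n → BraidGroup m)
    (ht : ∀ i, braidElt A (t i) = F i)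
    (hF : ∀ i j, i < j → j < n → F i * F j = F j * F i) :
    braidElt A (List.ofFn t).prod = seqProd F n := by
  induction n with
  | zero => exact braidElt_one m
  | succ n ih =>
    rw [List.ofFn_succ', List.prod_concat, braidElt_mul, ht,
      ih _ (fun i => ht i.castSucc) (fun i j hi hj => hF i j hi (by omega)), Fin.val_last,
      ← seqProd_commute fun i hi => hF i n hi (by omega)]
    rfl

theorem braidElt_directSum {k m : ℕ} {j : Fin k → ℕ} (t : ∀ i, BraidGroup (j i))
    (h : m = ∑ i, j i) :
    braidElt A (directSum t h) =
      seqProd (fun i => bpow (width (extendFin 0 j) i) ⬝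
        extendFin I (fun i => braidElt A (t i)) i) k := by
  refine braidElt_prod_ofFn _ (fun i => ?_) ?_
  · rw [braidElt_place, offset_eq_width j i.2.le, extendFin_val]
  · intro a b hab hb
    rw [extendFin_of_lt _ _ hb, extendFin_of_lt _ _ (hab.trans hb)]
    -- The braid in block `a` involves only strands up to the end of that block, and block `b`
    -- begins there or later; the difference is the added shift.
    have h1 := ((arity_braidElt (A := A) (t ⟨a, hab.trans hb⟩)).bpow_app
      (width (extendFin 0 j) a)).exch_add
        (width (extendFin 0 j) b - width (extendFin 0 j) (a + 1)) (braidElt A (t ⟨b, hb⟩))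
    have h2 := width_mono (extendFin 0 j) (Nat.succ_le_of_lt hab)
    have h3 := width_succ (extendFin 0 j) a
    rw [extendFin_of_lt 0 j (hab.trans hb)] at h3
    rw [show j ⟨a, hab.trans hb⟩ + width (extendFin 0 j) a +
      (width (extendFin 0 j) b - width (extendFin 0 j) (a + 1)) = width (extendFin 0 j) b by
        simp only [Nat.succ_eq_add_one] at h2; omega] at h1
    exact h1.symm

end BCStructure

/-! ### The internal operad is a closed braided operad -/

namespace InternalOperad

open BCStructure IsExtensionalBC BraidGroup

section

variable {A : Type u} [BCStructure A] [IsExtensionalBC A]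

attribute [local instance] cmpMonoid

/-- The element that underlies an operator of the internal operad. -/
def val {m : ℕ} (x : (data A).Op m) : A := Subtype.val x

theorem val_injective {m : ℕ} : Function.Injective (val : (data A).Op m → A) :=
  Subtype.val_injective

theorem arity_val {m : ℕ} (x : (data A).Op m) : Arity m 1 (val x) := arity x

theorem val_comp {n m : ℕ} {k : Fin n → ℕ} (g : (data A).Op n) (f : ∀ i, (data A).Op (k i))
    (h : m = ∑ i, k i) :
    val ((data A).comp g f h) = tensorFin (fun i => val (f i)) * val g :=
  foldr_tensorFin _ _

theorem val_act {m : ℕ} (x : (data A).Op m) (s : BraidGroup m) :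
    val ((data A).act x s) = braidElt A s * val x := by
  induction s using BraidGroup.induction generalizing x with
  | one => rw [braidElt_one, one_mul]; simp [data, val]; rfl
  | gen i hi =>
    rw [braidElt_σ hi, σ, dif_pos (by omega)]
    simp only [data, braidAct, lift_of]
    rfl
  | inv i hi _ =>
    rw [braidElt_σ_inv hi, σ, dif_pos (by omega)]
    simp only [data, braidAct, map_inv, lift_of]
    rfl
  | mul s t hs ht =>
    have : (data A).act x (s * t) = (data A).act ((data A).act x s) t := by
      simp [data]; rfl
    rw [this, ht, hs, braidElt_mul, mul_assoc]

theorem val_one : val (data A).one = I := rfl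

theorem val_app : val (data A).app = B := rfl

theorem val_apply {a b m : ℕ} (x : (data A).Op a) (y : (data A).Op b) (h : m = a + b) :
    val ((data A).apply x y h) = val x ⊚ (B ⬝ val y ⊚ B) := by
  change bpow 0 ⬝ val x ⊚ (bpow 1 ⬝ val y ⊚ B) = _
  rw [bpow_zero_app, bpow_one_app]

theorem val_apply_one {m : ℕ} (x : (data A).Op m) :
    val ((data A).apply x (data A).one rfl) = val x ⊚ B := by
  rw [val_apply, val_one, lam, I_cmp]

theorem tensor_I (n : ℕ) : tensor (fun _ => (I : A)) n = 1 := by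
  induction n with
  | zero => rfl
  | succ n ih => rw [tensor_succ, ih, one_mul, bpow_app_I]; rfl

/-- The operator `a^• ∘ B^m`. -/
def ofElt (m : ℕ) (a : A) : (data A).Op m := ⟨bullet a ⊚ bpow m, a, rfl⟩

theorem val_ofElt (m : ℕ) (a : A) : val (ofElt m a) = bullet a ⊚ bpow m := rfl

theorem val_ofElt_app_I (m : ℕ) (a : A) : val (ofElt m a) ⬝ I = a := by
  rw [val_ofElt, cmp_app, bpow_app_I, bullet_app, I_app]

/-- With `val_ofElt_app_I`, this makes `ofElt m` a bijection from the algebra onto `I_A(m)`, with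
evaluation at `I` as its inverse. -/
theorem ofElt_val_app_I {m : ℕ} (x : (data A).Op m) : ofElt m (val x ⬝ I) = x := by
  obtain ⟨_, a, rfl⟩ := x
  exact congrArg _ (val_ofElt_app_I m a)

/-- Thus `app(-, id)` raises the arity but keeps the underlying element of the algebra, which is the
source of closedness. -/
theorem apply_ofElt_one (m : ℕ) (a : A) :
    (data A).apply (ofElt m a) (data A).one rfl = ofElt (m + 1) a :=
  val_injective (by rw [val_apply_one, val_ofElt, val_ofElt, cmp_assoc, ← bpow_succ'])

theorem isClosedBraidedOperad : (data A).IsClosedBraidedOperad where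
  comp_one {n} f := by
    refine val_injective ((val_comp _ _ _).trans ?_)
    rw [tensorFin, tensor_congr (G := fun _ => I) fun i hi => extendFin_of_lt _ _ hi, tensor_I,
      one_mul]
  one_comp {n} f := by
    refine val_injective ?_
    change bpow 0 ⬝ val f ⊚ I = val f
    rw [bpow_zero_app, cmp_I]
  comp_assoc {n N k r l} h g f hr hN := by
    refine val_injective ?_
    rw [val_comp, val_comp]
    simp only [val_comp]
    -- Interchange collects the inner juxtapositions in front, where they form one juxtaposition
    -- over the flattened positions.
    rw [tensorFin_mul _ fun i => arity_val (g i), mul_assoc,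
      tensorFin_sigma rfl fun i j => val (f i j)]
    intro i j
    have : finSigmaFinEquiv.symm (finSigmaFinEquiv (⟨i, j⟩ : (i : Fin n) × Fin (k i))) = ⟨i, j⟩ :=
      Equiv.symm_apply_apply _ _
    simp only [Fin.cast_eq_self]
    rw [this]
  act_one f := val_injective (by rw [val_act, braidElt_one, one_mul])
  act_mul f s t := val_injective (by rw [val_act, val_act, val_act, braidElt_mul, mul_assoc])
  act_comp {k m j} f s g h := by
    refine val_injective ?_
    rw [val_comp, val_act, val_act, val_comp, ← mul_assoc, ← mul_assoc,
      tensorFin_mul_braidElt s h fun i => arity_val (g i)]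
  comp_act {k m j} f g t h := by
    refine val_injective ?_
    rw [val_comp, val_act, val_comp, braidElt_directSum, ← mul_assoc,
      ← tensorFin_mul _ fun i => arity_val (g i)]
    simp only [val_act]
  closed {n} p := by
    -- The element underlying `p` is its value at `I`. Any `q` with `app(q, id) = p` has the same
    -- value there, because `B I = I`.
    refine ⟨ofElt n (val p ⬝ I), ?_, fun q hq => ?_⟩
    · exact (apply_ofElt_one _ _).trans (ofElt_val_app_I p)
    · rw [← hq, val_apply_one, cmp_app]
      refine (ofElt_val_app_I q).symm.trans ?_
      rw [show (B ⬝ I : A) = I from lam]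

end

/-! ### Functoriality of the internal operad -/

theorem map_C {A A' : ExtBCAlgebra.{u}} (h : A ⟶ A') (s : Bool) : h.toFun (C s) = C s := by
  cases s
  · exact h.isHom.map_Cneg
  · exact h.isHom.map_Cpos

theorem map_cmp {A A' : ExtBCAlgebra.{u}} (h : A ⟶ A') (x y : A.carrier) :
    h.toFun (x ⊚ y) = h.toFun x ⊚ h.toFun y := by
  simp only [BCStructure.cmp, h.isHom.map_app, h.isHom.map_B]

theorem map_foldr {A A' : ExtBCAlgebra.{u}} (h : A ⟶ A') (l : List A.carrier) (g : A.carrier) :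
    h.toFun (l.foldr BCStructure.cmp g) = (l.map h.toFun).foldr BCStructure.cmp (h.toFun g) := by
  induction l with
  | nil => rfl
  | cons x l ih => rw [List.foldr_cons, map_cmp, ih, List.map_cons, List.foldr_cons]

theorem map_braidElt {A A' : ExtBCAlgebra.{u}} (h : A ⟶ A') {m : ℕ} (s : BraidGroup m) :
    h.toFun (braidElt A.carrier s) = braidElt A'.carrier s := by
  induction s using BraidGroup.induction with
  | one => rw [braidElt_one, braidElt_one]; exact h.isHom.map_I
  | gen i hi =>
    rw [braidElt_σ hi, braidElt_σ hi, crossElt, crossElt, h.isHom.map_app, map_bpow, map_C]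
  | inv i hi _ =>
    rw [braidElt_σ_inv hi, braidElt_σ_inv hi, h.isHom.map_app, map_bpow, map_C]
  | mul s t hs ht => rw [braidElt_mul, braidElt_mul, ← hs, ← ht]; exact map_cmp h _ _

theorem val_map {A A' : ExtBCAlgebra.{u}} (h : A ⟶ A') {m : ℕ} (x : (data A.carrier).Op m) :
    val (InternalOperad.map h m x : (data A'.carrier).Op m) = h.toFun (val x) := rfl

theorem isHom_map {A A' : ExtBCAlgebra.{u}} (h : A ⟶ A') :
    OperadData.IsHom (data A.carrier) (data A'.carrier) (InternalOperad.map h) where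
  map_one := Subtype.ext h.isHom.map_I
  map_comp {n m k} g f e := by
    refine Subtype.ext ?_
    change h.toFun (List.foldr _ _ _) = List.foldr _ _ _
    rw [map_foldr, List.map_ofFn]
    congr 2
    funext i
    exact (h.isHom.map_app _ _).trans (by rw [map_bpow]; rfl)
  map_act f s := by
    refine val_injective ((val_map h _).trans ((congrArg _ (val_act f s)).trans ?_))
    refine (map_cmp h _ _).trans (.trans ?_ (val_act (InternalOperad.map h _ f) s).symm)
    rw [map_braidElt]
    rfl
  map_app := Subtype.ext h.isHom.map_B

end InternalOperad

/-! ### Application and substitution for operators of all arities -/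

namespace ClosedBraidedOperad

open BCStructure BraidGroup

variable (P : ClosedBraidedOperad.{u})

/-- The operators of all arities. -/
def Total : Type u := (n : ℕ) × P.Op n

variable {P}

/-- An operator among the operators of all arities. -/
def tot {n : ℕ} (x : P.Op n) : P.Total := ⟨n, x⟩

/-- The number of arguments. -/
def Total.deg (x : P.Total) : ℕ := x.1

/-- The underlying operator. -/
def Total.op (x : P.Total) : P.Op x.deg := x.2

theorem tot_injective {n : ℕ} : Function.Injective (tot : P.Op n → P.Total) :=
  sigma_mk_injective

variable (P) in
/-- The identity operator. -/
def unit : P.Total := tot P.one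

/-- The constants are those of `P(0)`, but they can now be applied to identities, which play the
role of variables. The rule `C a b c = a c b` holds here only up to a braid. -/
noncomputable instance : BCStructure P.Total where
  app x y := tot (P.apply x.op y.op rfl)
  B := tot P.zeroStructure.B
  Cpos := tot P.zeroStructure.Cpos
  Cneg := tot P.zeroStructure.Cneg
  I := tot P.zeroStructure.I

theorem tot_apply {a b m : ℕ} (x : P.Op a) (y : P.Op b) (h : m = a + b) :
    tot (P.apply x y h) = tot x ⬝ tot y := by
  subst h; rfl

theorem deg_apply (x y : P.Total) : (x ⬝ y).deg = x.deg + y.deg := rfl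

theorem deg_unit : P.unit.deg = 1 := rfl

theorem deg_B : (B : P.Total).deg = 0 := rfl

theorem deg_I : (I : P.Total).deg = 0 := rfl

theorem deg_C (s : Bool) : (C s : P.Total).deg = 0 := by cases s <;> rfl

/-- The composite `x(v_0, …, v_{n-1})`. -/
def sub {n : ℕ} (x : P.Op n) (v : Fin n → P.Total) : P.Total :=
  tot (P.comp x (fun i => (v i).op) rfl)

theorem tot_comp {n m : ℕ} {k : Fin n → ℕ} (g : P.Op n) (f : ∀ i, P.Op (k i))
    (h : m = ∑ i, k i) : tot (P.comp g f h) = sub g fun i => tot (f i) := by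
  subst h; rfl

theorem sub_one (v : Fin 1 → P.Total) : sub P.one v = v 0 := by
  have h := congrArg tot (P.laws.one_comp (v 0).op)
  rw [tot_comp] at h
  refine .trans (congrArg _ ?_) h
  funext i
  rw [Subsingleton.elim i 0]
  rfl

theorem sub_unit {n : ℕ} (x : P.Op n) : sub x (fun _ => P.unit) = tot x := by
  have h := congrArg tot (P.laws.comp_one x)
  rwa [tot_comp] at h

/-- Associativity of the operad, with positions of the composite addressed as pairs. Keeping the
arguments in `P.Total` avoids transport between equal arities. -/
theorem sub_comp {n N : ℕ} {k : Fin n → ℕ} (h : P.Op n) (g : ∀ i, P.Op (k i)) (hN : N = ∑ i, k i)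
    (v : Fin N → P.Total) :
    sub (P.comp h g hN) v =
      sub h fun i => sub (g i) fun j => v (Fin.cast hN.symm (finSigmaFinEquiv ⟨i, j⟩)) := by
  subst hN
  have e := congrArg tot (P.laws.comp_assoc h g
    (fun i j => (v (finSigmaFinEquiv ⟨i, j⟩)).op) (fun _ => rfl) rfl)
  rw [tot_comp, tot_comp] at e
  refine .trans (congrArg _ ?_) e.symm
  funext p
  change v p = v (finSigmaFinEquiv (finSigmaFinEquiv.symm p))
  rw [Equiv.apply_symm_apply]

theorem sub_app (v : Fin 2 → P.Total) : sub P.app v = v 0 ⬝ v 1 := by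
  refine .symm ((tot_comp _ _ _).trans (congrArg _ ?_))
  funext i
  fin_cases i <;> rfl

theorem sub_apply {a b m : ℕ} (x : P.Op a) (y : P.Op b) (h : m = a + b) (v : Fin m → P.Total) :
    sub (P.apply x y h) v =
      sub x (fun i => v (Fin.cast h.symm (Fin.castAdd b i))) ⬝
        sub y (fun j => v (Fin.cast h.symm (Fin.natAdd a j))) := by
  rw [OperadData.apply, sub_comp, sub_app]
  congr 2
  · funext i
    refine congrArg v (Fin.ext ?_)
    rw [Fin.val_cast, finSigmaFinEquiv_apply]
    simp
    rfl

theorem sub_apply_one {n : ℕ} (x : P.Op n) (v : Fin (n + 1) → P.Total) :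
    sub (P.apply x P.one rfl) v = sub x (fun i => v i.castSucc) ⬝ v (Fin.last n) := by
  rw [sub_apply, sub_one]
  rfl

theorem abs_spec {n : ℕ} (p : P.Op (n + 1)) : P.apply (P.abs p) P.one rfl = p :=
  (P.laws.closed p).choose_spec.1

theorem sub_abs {n : ℕ} (p : P.Op (n + 1)) (v : Fin (n + 1) → P.Total) :
    sub (P.abs p) (fun i => v i.castSucc) ⬝ v (Fin.last n) = sub p v := by
  rw [← sub_apply_one, abs_spec]

theorem sub_zero (p : P.Op 0) (v : Fin 0 → P.Total) : sub p v = tot p := by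
  rw [← sub_unit]
  exact congrArg _ (Subsingleton.elim _ _)

theorem abs_apply (p : P.Op 1) (x : P.Total) : tot (P.abs p) ⬝ x = sub p ![x] := by
  rw [← sub_abs, sub_zero]
  rfl

theorem abs_abs_abs_apply (p : P.Op 3) (x y z : P.Total) :
    tot (P.abs (P.abs (P.abs p))) ⬝ x ⬝ y ⬝ z = sub p ![x, y, z] := by
  rw [← sub_abs p, ← sub_abs (P.abs p), abs_apply]
  congr 3
  funext i
  rw [Subsingleton.elim i 0]
  rfl

/-- Extensionality: the arities agree because application to the identity adds one, and then
uniqueness in closedness applies. -/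
theorem unit_ext {x y : P.Total} (h : x ⬝ P.unit = y ⬝ P.unit) : x = y := by
  obtain ⟨a, x⟩ := x
  obtain ⟨b, y⟩ := y
  obtain rfl : a = b := Nat.succ_injective (congrArg Total.deg h)
  have h := tot_injective h
  exact congrArg tot ((P.laws.closed (P.apply y P.one rfl)).unique h rfl)

theorem I_apply (x : P.Total) : I ⬝ x = x :=
  (abs_apply _ _).trans (sub_one _)

theorem B_apply (x y z : P.Total) : B ⬝ x ⬝ y ⬝ z = x ⬝ (y ⬝ z) := by
  refine (abs_abs_abs_apply _ _ _ _).trans ?_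
  rw [sub_apply, sub_one, sub_app]
  rfl

/-- The action of a braid that is given on any number of strands. -/
def Total.braid (x : P.Total) (β : ∀ n, BraidGroup n) : P.Total := tot (P.act x.op (β x.deg))

theorem braid_braid (x : P.Total) (β γ : ∀ n, BraidGroup n) :
    (x.braid β).braid γ = x.braid (β * γ) :=
  congrArg tot (P.laws.act_mul _ _ _).symm

theorem braid_congr {x : P.Total} {β γ : ∀ n, BraidGroup n} (h : β x.deg = γ x.deg) :
    x.braid β = x.braid γ :=
  congrArg (fun s => tot (P.act x.op s)) h

theorem braid_one {x : P.Total} {β : ∀ n, BraidGroup n} (h : β x.deg = 1) : x.braid β = x :=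
  congrArg tot ((congrArg _ h).trans (P.laws.act_one x.op))

theorem tot_act {n : ℕ} (x : P.Op n) (s : BraidGroup n) {β : ∀ n, BraidGroup n} (h : s = β n) :
    tot (P.act x s) = (tot x).braid β := by
  subst h; rfl

theorem sub_act {n : ℕ} (x : P.Op n) (s : BraidGroup n) (v : Fin n → P.Total)
    {β : ∀ n, BraidGroup n} (h : ∀ m (e : m = ∑ i, (v i).deg), cable s _ e = β m) :
    sub (P.act x s) v = (sub x fun i => v ((perm s)⁻¹ i)).braid β := by
  refine (congrArg tot (P.laws.act_comp x s _ rfl)).trans ?_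
  rw [tot_act _ _ (h _ rfl), tot_comp]
  rfl

/-- The generator `σ_i` or its inverse, on any number of strands. -/
def gen (s : Bool) (i n : ℕ) : BraidGroup n := if s then σ n i else (σ n i)⁻¹

/-- The action of `σ_i` or of its inverse. -/
def Total.cross (x : P.Total) (s : Bool) (i : ℕ) : P.Total := x.braid (gen s i)

theorem cross_cross_not (x : P.Total) (s : Bool) (i : ℕ) : (x.cross (!s) i).cross s i = x := by
  rw [Total.cross, Total.cross, braid_braid, braid_one]
  cases s <;> simp [gen]

theorem cross_near {x : P.Total} (s : Bool) {i : ℕ} (h : i + 2 < x.deg) :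
    ((x.cross s i).cross s (i + 1)).cross s i =
      ((x.cross s (i + 1)).cross s i).cross s (i + 1) := by
  simp only [Total.cross, braid_braid]
  refine braid_congr ?_
  have := σ_near h
  cases s
  · have := congrArg (·⁻¹) this
    simpa [gen, mul_assoc] using this
  · simpa [gen] using this

theorem place_gen {j m p : ℕ} (h : p + j ≤ m) (s : Bool) {i : ℕ} (hi : i + 1 < j) :
    place p h (gen s i j) = gen s (p + i) m := by
  have : place p h (σ j i) = σ m (p + i) := by rw [σ, dif_pos (by omega), place, lift_of]
  cases s <;> simp [gen, this]

theorem directSum_two {j : Fin 2 → ℕ} (t : ∀ i, BraidGroup (j i)) {m : ℕ} (h : m = ∑ i, j i) :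
    directSum t h =
      place 0 (by rw [h, Fin.sum_univ_two]; omega) (t 0) *
        place (j 0) (by rw [h, Fin.sum_univ_two]) (t 1) := by
  have h0 : offset j 0 = 0 := by simp [offset]
  have h1 : offset j 1 = j 0 := by
    have := offset_succ j 0
    simpa [h0] using this
  simp [directSum, List.ofFn_succ, h0, h1]

/-- Equivariance in the inner operators, for the operator `app`; `δ` is the direct sum of the two
braids. -/
theorem apply_braid {x y : P.Total} {β γ δ : ∀ n, BraidGroup n}
    (h : place 0 (by simp) (β x.deg) * place x.deg le_rfl (γ y.deg) = δ (x.deg + y.deg)) :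
    (x.braid β) ⬝ (y.braid γ) = (x ⬝ y).braid δ := by
  have e := P.laws.comp_act (j := ![x.deg, y.deg]) P.app
    (Fin.cons x.op (Fin.cons y.op finZeroElim))
    (Fin.cons (β x.deg) (Fin.cons (γ y.deg) finZeroElim)) (m := x.deg + y.deg) (by simp)
  have e := congrArg tot e
  rw [directSum_two] at e
  have e := e.trans (tot_act (P.apply x.op y.op rfl) _ h)
  refine .trans ?_ e
  rw [tot_comp, sub_app]
  rfl

theorem cross_apply {x : P.Total} (s : Bool) {i : ℕ} (h : i + 1 < x.deg) (y : P.Total) :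
    (x.cross s i) ⬝ y = (x ⬝ y).cross s i := by
  have e : y.braid (fun _ => 1) = y := braid_one rfl
  -- The argument `y` is regarded as acted on by the trivial braid, so that `apply_braid` covers
  -- both factors.
  rw [← e, Total.cross, e, Total.cross, ← e]
  refine (apply_braid ?_).trans (by rw [e])
  rw [map_one, mul_one, place_gen _ _ h, zero_add]

theorem apply_cross (x : P.Total) {y : P.Total} (s : Bool) {i : ℕ} (h : i + 1 < y.deg) :
    x ⬝ (y.cross s i) = (x ⬝ y).cross s (x.deg + i) := by
  have e : x.braid (fun _ => 1) = x := braid_one rfl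
  rw [← e, Total.cross, Total.cross]
  refine (apply_braid ?_).trans (by rw [e])
  rw [map_one, one_mul, place_gen _ _ h]

theorem adjSwap_three (v : Fin 3 → P.Total) :
    (fun i => v ((perm (σ 3 1))⁻¹ i)) = ![v 0, v 2, v 1] := by
  have : (perm (σ 3 1))⁻¹ = adjSwap ⟨1, by omega⟩ := by
    rw [σ, dif_pos (by omega), perm, lift_of, adjSwap_inv]
  rw [this]
  funext i
  fin_cases i <;> exact congrArg v (Fin.ext (by rw [adjSwap_val]; simp))

theorem cable_three (w : Fin 3 → ℕ) {m : ℕ} (h : m = ∑ i, w i) :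
    cable (σ 3 1) w h = blockCross m (w 0) (w 1) (w 2) := by
  have h1 : offset w 1 = w 0 := by
    have := offset_succ w 0
    simpa [offset] using this
  rw [cable_σ (by omega), h1]
  rfl

theorem cable_inv {k : ℕ} (s : BraidGroup k) (w : Fin k → ℕ) {m : ℕ} (h : m = ∑ i, w i) :
    cable s⁻¹ w h = (cable s (w ∘ ⇑(perm s)) (Cabling.sum_comp _ h))⁻¹ := by
  have := cable_mul s s⁻¹ w h
  simp only [mul_inv_cancel, cable_one, map_inv, inv_inv] at this
  exact eq_inv_of_mul_eq_one_right this.symm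

/-- The braid that crosses two adjacent blocks of parallel strands. -/
def blockGen (s : Bool) (p a b n : ℕ) : BraidGroup n :=
  if s then blockCross n p a b else (blockCross n p b a)⁻¹

/-- Substituting `x`, `y`, `z` into the body of `C^±` cables the crossing of the last two strands,
by outer equivariance. For the negative sign the inverse cabling starts from the exchanged widths.
-/
theorem C_apply (s : Bool) (x y z : P.Total) :
    C s ⬝ x ⬝ y ⬝ z = (x ⬝ z ⬝ y).braid (blockGen s x.deg y.deg z.deg) := by
  have h1 : sub (P.apply P.app P.one rfl) ![x, z, y] = x ⬝ z ⬝ y := by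
    rw [sub_apply_one, sub_app]; rfl
  have hp : (perm (σ 3 1))⁻¹ = perm (σ 3 1) := by
    rw [σ, dif_pos (by omega), perm, lift_of, adjSwap_inv]
  have h2 := adjSwap_three ![x, y, z]
  cases s
  · refine (abs_abs_abs_apply _ _ _ _).trans ?_
    rw [sub_act _ _ _ (β := blockGen false x.deg y.deg z.deg), map_inv, hp]
    · rw [hp] at h2
      rw [hp, h2]
      exact congrArg (Total.braid · _) h1
    · intro m e
      rw [cable_inv, cable_three]
      have h3 : ∀ i, (![x, y, z] (perm (σ 3 1) i)).deg = (![x, z, y] i).deg := fun i => by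
        rw [← hp]
        exact congrArg Total.deg (congrFun h2 i)
      simp only [Function.comp_apply, h3]
      rfl
  · refine (abs_abs_abs_apply _ _ _ _).trans ?_
    rw [sub_act _ _ _ (β := blockGen true x.deg y.deg z.deg), h2]
    · exact congrArg (Total.braid · _) h1
    · intro m e
      rw [cable_three]
      rfl

/-- A block crossing with an empty block is trivial. -/
theorem C_apply_of_deg_left (s : Bool) (x : P.Total) {y : P.Total} (h : y.deg = 0) (z : P.Total) :
    C s ⬝ x ⬝ y ⬝ z = x ⬝ z ⬝ y := by
  have hb : ∀ n p b, blockCross n p b 0 = 1 := by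
    intro n p b
    induction b with
    | zero => rfl
    | succ b ih => rw [blockCross, ih, strandCross, one_mul]
  rw [C_apply, braid_one]
  cases s <;> simp [blockGen, h, hb, blockCross]

theorem C_apply_unit_unit (s : Bool) (x : P.Total) :
    C s ⬝ x ⬝ P.unit ⬝ P.unit = (x ⬝ P.unit ⬝ P.unit).cross s x.deg := by
  rw [C_apply]
  refine braid_congr ?_
  cases s <;> simp [blockGen, gen, deg_unit, blockCross, strandCross]

theorem C_apply_unit_pair (s : Bool) (x : P.Total) :
    C s ⬝ x ⬝ P.unit ⬝ (P.unit ⬝ P.unit) =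
      ((x ⬝ (P.unit ⬝ P.unit) ⬝ P.unit).cross s (x.deg + 1)).cross s x.deg := by
  rw [C_apply, Total.cross, Total.cross, braid_braid]
  refine braid_congr ?_
  cases s
  · simp only [blockGen, gen, deg_unit, deg_apply, blockCross, strandCross, one_mul, mul_one,
      add_zero, Bool.false_eq_true, if_false, Pi.mul_apply]
    exact mul_inv_rev _ _
  · simp [blockGen, gen, deg_unit, deg_apply, blockCross, strandCross]

end ClosedBraidedOperad

/-! ### The axioms of an extensional algebra in `P(0)` -/

namespace ClosedBraidedOperad

open BCStructure BraidGroup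

variable {P : ClosedBraidedOperad.{u}}

theorem C_apply_B (s : Bool) (x z : P.Total) : C s ⬝ x ⬝ B ⬝ z = x ⬝ z ⬝ B :=
  C_apply_of_deg_left s x deg_B z

theorem C_apply_I (s : Bool) (x z : P.Total) : C s ⬝ x ⬝ I ⬝ z = x ⬝ z ⬝ I :=
  C_apply_of_deg_left s x deg_I z

theorem C_apply_C (s t : Bool) (x z : P.Total) : C s ⬝ x ⬝ C t ⬝ z = x ⬝ z ⬝ C t :=
  C_apply_of_deg_left s x (deg_C t) z

theorem lam_tot : (B : P.Total) ⬝ I = I :=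
  unit_ext (unit_ext (by simp only [B_apply, I_apply]))

theorem rho_tot (t : Bool) : (C t : P.Total) ⬝ B ⬝ I = I :=
  unit_ext (unit_ext (by simp only [B_apply, I_apply, C_apply_I]))

/-- On four arguments `x`, `y`, `z`, `w` both sides evaluate to `x (y (z w))`. -/
theorem alpha_tot (t : Bool) : (B ⬝ B : P.Total) ⊚ B = (C t ⬝ B ⬝ B) ⊚ (B ⊚ B) :=
  unit_ext (unit_ext (unit_ext (unit_ext (by
    simp only [BCStructure.cmp, B_apply, C_apply_B]))))

theorem cox_one_tot (s : Bool) : (C s : P.Total) ⊚ C (!s) = I :=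
  unit_ext (unit_ext (unit_ext (by
    simp only [BCStructure.cmp, B_apply, I_apply, C_apply_unit_unit, deg_apply, deg_unit,
      deg_C, zero_add, cross_cross_not])))

theorem cox_two_tot (s t : Bool) :
    (B ⬝ C s : P.Total) ⊚ (B ⊚ B) = (C t ⬝ B ⬝ C s) ⊚ (B ⊚ B) :=
  unit_ext (unit_ext (unit_ext (unit_ext (by
    simp only [BCStructure.cmp, B_apply, C_apply_C, C_apply_unit_unit]
    -- On one side the crossing takes place inside an argument; taking it outside shifts its
    -- position by the arity of the function.
    rw [apply_cross _ _ (by simp [deg_apply, deg_unit])]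
    simp [deg_apply, deg_unit, deg_B]))))

/-- On four identities both sides become three successive crossings of adjacent strands, related by
the braid relation. -/
theorem cox_three_tot (s : Bool) :
    (B ⬝ C s : P.Total) ⊚ (C s ⊚ (B ⬝ C s)) = C s ⊚ ((B ⬝ C s) ⊚ C s) :=
  unit_ext (unit_ext (unit_ext (unit_ext (by
    simp only [BCStructure.cmp, B_apply, C_apply_unit_unit, deg_apply, deg_unit, deg_C]
    rw [cross_apply _ (by simp [deg_apply, deg_unit, deg_B]),
      cross_apply _ (by simp [deg_apply, deg_unit, deg_B, deg_C])]
    simp only [C_apply_unit_unit, deg_apply, deg_unit, deg_C]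
    rw [cross_apply _ (by simp [deg_apply, deg_unit])]
    exact (cross_near s (by simp [deg_apply, deg_unit])).symm))))

/-- On four identities both sides cross a strand with a pair: in one block crossing on the left,
where the pair is a single argument, and strand by strand on the right. -/
theorem bc_tot (s : Bool) : (B ⬝ B : P.Total) ⊚ C s = C s ⊚ ((B ⬝ C s) ⊚ B) :=
  unit_ext (unit_ext (unit_ext (unit_ext (by
    simp only [BCStructure.cmp, B_apply, C_apply_unit_unit, C_apply_unit_pair, deg_apply, deg_unit,
      deg_C]
    rw [cross_apply _ (by simp [deg_apply, deg_unit, deg_B, deg_C])]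
    simp only [C_apply_unit_unit, deg_apply, deg_unit, deg_B, B_apply]))))

theorem tot_C (s : Bool) : tot (@C _ P.zeroStructure s) = C s := by cases s <;> rfl

theorem isExtensionalBC (P : ClosedBraidedOperad.{u}) :
    @IsExtensionalBC (P.Op 0) P.zeroStructure := by
  let _ := P.zeroStructure
  have happ : ∀ a b : P.Op 0, tot (a ⬝ b) = tot a ⬝ tot b := fun _ _ => rfl
  have hB : tot (B : P.Op 0) = B := rfl
  have hI : tot (I : P.Op 0) = I := rfl
  have hP : ∀ a b : P.Op 0, Cpos ⬝ a ⬝ b = C true ⬝ a ⬝ b := fun _ _ => rfl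
  have hN : ∀ a b : P.Op 0, Cneg ⬝ a ⬝ b = C false ⬝ a ⬝ b := fun _ _ => rfl
  have hcmp : ∀ a b : P.Op 0, tot (a ⊚ b) = tot a ⊚ tot b := fun _ _ => rfl
  constructor
  · intro a b c
    refine tot_injective ?_
    simp only [happ, hB, B_apply]
  · intro t a b c
    refine tot_injective ?_
    simp only [happ, tot_C]
    exact C_apply_of_deg_left _ _ rfl _
  · intro a
    refine tot_injective ?_
    simp only [happ, hI, I_apply]
  · intro a b
    -- One further argument lets both signs reduce; as `b` has no strands, no crossing remains to
    -- tell them apart.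
    refine tot_injective (unit_ext ?_)
    simp only [hP, hN, happ, tot_C]
    rw [C_apply_of_deg_left _ _ rfl, C_apply_of_deg_left _ _ rfl]
  · refine tot_injective ?_
    simp only [happ, hB, hI, lam_tot]
  · intro t
    refine tot_injective ?_
    simp only [happ, tot_C, hB, hI, rho_tot]
  · intro t
    refine tot_injective ?_
    simp only [happ, hcmp, tot_C, hB, alpha_tot t]
  · intro s
    refine tot_injective ?_
    simp only [hcmp, tot_C, hI, cox_one_tot]
  · intro s t
    refine tot_injective ?_
    simp only [happ, hcmp, tot_C, hB, cox_two_tot s t]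
  · intro s
    refine tot_injective ?_
    simp only [happ, hcmp, tot_C, hB, cox_three_tot s]
  · intro s
    refine tot_injective ?_
    simp only [happ, hcmp, tot_C, hB, bc_tot s]

/-! ### Functoriality of `P(0)` -/

theorem abs_unique {n : ℕ} {p : P.Op (n + 1)} {q : P.Op n} (h : P.apply q P.one rfl = p) :
    q = P.abs p :=
  (P.laws.closed p).unique h (abs_spec p)

theorem map_apply {Q : ClosedBraidedOperad.{u}} (φ : P ⟶ Q) {a b m : ℕ} (x : P.Op a) (y : P.Op b)
    (h : m = a + b) :
    φ.toFun m (P.apply x y h) = Q.apply (φ.toFun a x) (φ.toFun b y) h := by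
  rw [OperadData.apply, φ.isHom.map_comp, φ.isHom.map_app, OperadData.apply]
  congr 1
  funext i
  fin_cases i <;> rfl

theorem map_abs {Q : ClosedBraidedOperad.{u}} (φ : P ⟶ Q) {n : ℕ} (p : P.Op (n + 1)) :
    φ.toFun n (P.abs p) = Q.abs (φ.toFun (n + 1) p) :=
  abs_unique (by
    have := map_apply φ (P.abs p) P.one rfl
    rw [φ.isHom.map_one] at this
    rw [← this, abs_spec])

theorem isBCHom_zero {Q : ClosedBraidedOperad.{u}} (φ : P ⟶ Q) :
    IsBCHom P.zeroStructure Q.zeroStructure (φ.toFun 0) where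
  map_app a b := map_apply φ (a := 0) (b := 0) (m := 0) a b rfl
  map_B := by
    change φ.toFun 0 (P.abs (P.abs (P.abs (P.apply P.one P.app rfl)))) = _
    simp only [map_abs, map_apply, φ.isHom.map_one, φ.isHom.map_app]
    rfl
  map_Cpos := by
    change φ.toFun 0 (P.abs (P.abs (P.abs (P.act (P.apply P.app P.one rfl) (σ 3 1))))) = _
    simp only [map_abs, map_apply, φ.isHom.map_act, φ.isHom.map_one, φ.isHom.map_app]
    rfl
  map_Cneg := by
    change φ.toFun 0 (P.abs (P.abs (P.abs (P.act (P.apply P.app P.one rfl) (σ 3 1)⁻¹)))) = _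
    simp only [map_abs, map_apply, φ.isHom.map_act, φ.isHom.map_one, φ.isHom.map_app]
    rfl
  map_I := by
    change φ.toFun 0 (P.abs P.one) = _
    simp only [map_abs, φ.isHom.map_one]
    rfl

end ClosedBraidedOperad

/-! ### The counit -/

namespace ClosedBraidedOperad

open BCStructure BraidGroup

section Counit

variable {P : ClosedBraidedOperad.{u}}

/-- The operator `app(… app(a, id) …, id)` with `m` identities. -/
def up (P : ClosedBraidedOperad.{u}) : ∀ m : ℕ, P.Op 0 → P.Op m
  | 0, a => a
  | m + 1, a => P.apply (P.up m a) P.one rfl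

theorem map_up {Q : ClosedBraidedOperad.{u}} (φ : P ⟶ Q) (m : ℕ) (a : P.Op 0) :
    φ.toFun m (P.up m a) = Q.up m (φ.toFun 0 a) := by
  induction m with
  | zero => rfl
  | succ m ih => rw [up, map_apply, ih, φ.isHom.map_one, up]

theorem tot_up (m : ℕ) (a : P.Op 0) :
    tot (P.up m a) = (List.replicate m P.unit).foldl BCStructure.app (tot a) := by
  induction m with
  | zero => rfl
  | succ m ih =>
    rw [up, tot_apply, ih, List.replicate_succ', List.foldl_append]
    rfl

theorem sub_up {n : ℕ} (a : P.Op 0) (v : Fin n → P.Total) :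
    sub (P.up n a) v = (List.ofFn v).foldl BCStructure.app (tot a) := by
  induction n with
  | zero => exact sub_zero _ _
  | succ n ih =>
    rw [up, sub_apply_one, ih, List.ofFn_succ', List.concat_eq_append, List.foldl_append]
    rfl

/-- `B^r f` waits until its first argument has received `r` further arguments and then applies `f`
to the result. -/
theorem foldl_bpow (f : P.Total) (l : List P.Total) (z : P.Total) :
    l.foldl BCStructure.app (bpow l.length ⬝ f ⬝ z) = f ⬝ l.foldl BCStructure.app z := by
  induction l generalizing z with
  | nil => simp only [List.length_nil, bpow, I_apply, List.foldl_nil]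
  | cons y l ih =>
    simp only [List.length_cons, bpow, List.foldl_cons, BCStructure.cmp, B_apply]
    exact ih _

theorem bullet_apply {a : P.Total} (h : a.deg = 0) (y : P.Total) : bullet a ⬝ y = y ⬝ a :=
  (C_apply_of_deg_left true I h y).trans (by rw [I_apply])

theorem foldl_bullet_bpow {a : P.Total} (h : a.deg = 0) (k : ℕ) (z : P.Total) :
    (List.replicate k P.unit).foldl BCStructure.app ((bullet a ⊚ bpow k) ⬝ z) =
      z ⬝ (List.replicate k P.unit).foldl BCStructure.app a := by
  have := foldl_bpow z (List.replicate k P.unit) a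
  rw [List.length_replicate] at this
  rw [BCStructure.cmp, B_apply, bullet_apply h, this]

/-- Evaluation of a composite of the internal operad. The induction is generalised to `r` arguments
`l` that are already complete; correspondingly the remaining factors are shifted by `r`. -/
theorem foldl_foldr_cmp {n : ℕ} {k : Fin n → ℕ} {F b : Fin n → P.Total} (g : P.Total) (r : ℕ)
    (hF : ∀ i z, (List.replicate (k i) P.unit).foldl BCStructure.app (F i ⬝ z) = z ⬝ b i)
    (l : List P.Total) (hl : l.length = r) :
    (l ++ List.replicate (∑ i, k i) P.unit).foldl BCStructure.app
        ((List.ofFn fun i : Fin n => bpow (i + r) ⬝ F i).foldr BCStructure.cmp g ⬝ I) =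
      (l ++ List.ofFn b).foldl BCStructure.app (g ⬝ I) := by
  induction n generalizing r l with
  | zero => simp
  | succ n ih =>
    have e : ∀ i : Fin n, (i.succ : ℕ) + r = i + (r + 1) := fun i => by simp; omega
    have := ih (k := fun i => k i.succ) (F := fun i => F i.succ) (b := fun i => b i.succ) (r + 1)
      (fun i => hF _) (l ++ [b 0]) (by simp [hl])
    rw [List.ofFn_succ, List.foldr_cons, Fin.sum_univ_succ, List.replicate_add, List.ofFn_succ,
      BCStructure.cmp, B_apply, Fin.val_zero, zero_add, List.foldl_append, List.foldl_append,
      ← hl, foldl_bpow, hF, hl]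
    simp only [e]
    rw [List.append_cons l, ← this, List.foldl_append, List.foldl_append]
    rfl

theorem deg_foldl_replicate (x : P.Total) (n : ℕ) :
    ((List.replicate n P.unit).foldl BCStructure.app x).deg = x.deg + n := by
  induction n generalizing x with
  | zero => rfl
  | succ n ih =>
    rw [List.replicate_succ, List.foldl_cons, ih, deg_apply, deg_unit]
    omega

theorem foldl_cross {x : P.Total} (s : Bool) {i : ℕ} (h : i + 1 < x.deg) (l : List P.Total) :
    l.foldl BCStructure.app (x.cross s i) = (l.foldl BCStructure.app x).cross s i := by
  induction l generalizing x with
  | nil => rfl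
  | cons y l ih =>
    rw [List.foldl_cons, cross_apply s h, List.foldl_cons]
    exact ih (by rw [deg_apply]; omega)

/-- The shift by `i` consumes `i` identities, so `C⁺` meets an operator of arity `i` and crosses
positions `i` and `i + 1`. The later identities do not affect the crossing. -/
theorem foldl_crossElt {z : P.Total} (hz : z.deg = 0) (i d : ℕ) :
    (List.replicate (i + (2 + d)) P.unit).foldl BCStructure.app (bpow i ⬝ C true ⬝ z) =
      ((List.replicate (i + (2 + d)) P.unit).foldl BCStructure.app z).cross true i := by
  have h1 := foldl_bpow (C true) (List.replicate i P.unit) z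
  have h2 := deg_foldl_replicate z i
  rw [hz, zero_add] at h2
  rw [List.length_replicate] at h1
  rw [List.replicate_add, List.foldl_append, List.foldl_append, h1, add_comm 2,
    List.replicate_succ, List.replicate_succ]
  simp only [List.foldl_cons]
  rw [C_apply_unit_unit, h2, foldl_cross]
  simp [deg_apply, h2, deg_unit]

/-- The extensional algebra `P(0)`. -/
noncomputable def zero (P : ClosedBraidedOperad.{u}) : ExtBCAlgebra.{u} :=
  @ExtBCAlgebra.mk (P.Op 0) P.zeroStructure (isExtensionalBC P)

/-- The inclusion of `P(0)`. -/
def incl (a : P.zero.carrier) : P.Total := tot (n := 0) a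

theorem incl_app (a b : P.zero.carrier) : incl (a ⬝ b) = incl a ⬝ incl b := rfl

theorem incl_cmp (a b : P.zero.carrier) : incl (a ⊚ b) = incl a ⊚ incl b := rfl

theorem incl_I : incl (I : P.zero.carrier) = I := rfl

theorem incl_B : incl (B : P.zero.carrier) = B := rfl

theorem incl_C (s : Bool) : incl (C s : P.zero.carrier) = C s := tot_C s

theorem incl_bullet (a : P.zero.carrier) : incl (bullet a) = bullet (incl a) := rfl

theorem incl_bpow (m : ℕ) : incl (bpow m : P.zero.carrier) = bpow m := by
  induction m with
  | zero => rfl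
  | succ m ih => rw [bpow, incl_cmp, ih, incl_B, bpow]

theorem incl_foldr (l : List P.zero.carrier) (g : P.zero.carrier) :
    incl (l.foldr BCStructure.cmp g) = (l.map incl).foldr BCStructure.cmp (incl g) := by
  induction l with
  | nil => rfl
  | cons x l ih => rw [List.foldr_cons, incl_cmp, ih, List.map_cons, List.foldr_cons]

open InternalOperad

/-- The counit of the adjunction: `a^• ∘ B^m` is sent to `app(… app(a, id) …, id)`. -/
noncomputable def counitFun (P : ClosedBraidedOperad.{u}) (m : ℕ)
    (x : (data P.zero.carrier).Op m) : P.Op m :=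
  P.up m (val x ⬝ I :)

theorem tot_counitFun {m : ℕ} (x : (data P.zero.carrier).Op m) :
    tot (P.counitFun m x) = (List.replicate m P.unit).foldl BCStructure.app (incl (val x) ⬝ I) :=
  tot_up _ _

theorem counitFun_act_σ {m i : ℕ} (hi : i + 1 < m) (x : (data P.zero.carrier).Op m) :
    P.counitFun m ((data P.zero.carrier).act x (σ m i)) = P.act (P.counitFun m x) (σ m i) := by
  refine tot_injective ?_
  obtain ⟨d, rfl⟩ : ∃ d, m = i + (2 + d) := ⟨m - (i + 2), by omega⟩
  have hz : (incl (val x) ⬝ I).deg = 0 := rfl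
  have e := (tot_act (P.counitFun _ x) (σ (i + (2 + d)) i) (β := gen true i) rfl)
  refine .trans ?_ e.symm
  rw [tot_counitFun, tot_counitFun, val_act, braidElt_σ hi, mul_eq_cmp, incl_cmp,
    BCStructure.cmp, B_apply, crossElt, incl_app, incl_bpow, incl_C]
  exact foldl_crossElt hz i d

theorem counitFun_act {m : ℕ} (x : (data P.zero.carrier).Op m) (s : BraidGroup m) :
    P.counitFun m ((data P.zero.carrier).act x s) = P.act (P.counitFun m x) s := by
  have hl := isClosedBraidedOperad (A := P.zero.carrier)
  induction s using BraidGroup.induction generalizing x with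
  | one => rw [hl.act_one, P.laws.act_one]
  | gen i hi => exact counitFun_act_σ hi x
  | inv i hi ih =>
    have := ih ((data P.zero.carrier).act x (σ m i)⁻¹)
    rw [← hl.act_mul, inv_mul_cancel, hl.act_one] at this
    rw [this, ← P.laws.act_mul, mul_inv_cancel, P.laws.act_one]
  | mul s t hs ht => rw [hl.act_mul, ht, hs, P.laws.act_mul]

theorem counitFun_comp {n m : ℕ} {k : Fin n → ℕ} (g : (data P.zero.carrier).Op n)
    (f : ∀ i, (data P.zero.carrier).Op (k i)) (h : m = ∑ i, k i) :
    P.counitFun m ((data P.zero.carrier).comp g f h) =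
      P.comp (P.counitFun n g) (fun i => P.counitFun (k i) (f i)) h := by
  refine tot_injective ?_
  subst h
  have e : val ((data P.zero.carrier).comp g f rfl) =
      (List.ofFn fun i : Fin n => bpow (i : ℕ) ⬝ val (f i)).foldr BCStructure.cmp (val g) := rfl
  rw [tot_comp, tot_counitFun, e, incl_foldr, List.map_ofFn]
  have := foldl_foldr_cmp (k := k) (F := fun i => incl (val (f i)))
    (b := fun i => tot (P.counitFun _ (f i))) (incl (val g)) 0 ?_ [] rfl
  · simp only [add_zero, List.nil_append] at this
    refine .trans ?_ (this.trans ?_)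
    · congr 4
      funext i
      simp only [Function.comp_apply, incl_app, incl_bpow]
    · exact (sub_up _ _).symm
  · intro i z
    -- Each inner operator has the form `a^• ∘ B^k`, so it gathers `k` identities into `app(… app(a,
    -- id) …, id)`.
    have h1 := congrArg val (ofElt_val_app_I (f i))
    rw [val_ofElt] at h1
    rw [tot_counitFun, ← incl_I, ← incl_app, ← foldl_bullet_bpow rfl, ← incl_bullet, ← incl_bpow,
      ← incl_cmp, h1]

theorem isHom_counitFun (P : ClosedBraidedOperad.{u}) :
    OperadData.IsHom (data P.zero.carrier) P.toOperadData P.counitFun where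
  map_one := tot_injective (by
    rw [tot_counitFun, val_one, incl_I]
    simp only [List.replicate, List.foldl_cons, List.foldl_nil, I_apply]
    rfl)
  map_comp := counitFun_comp
  map_act := counitFun_act
  map_app := tot_injective (by
    rw [tot_counitFun, val_app, incl_B]
    simp only [List.replicate, List.foldl_cons, List.foldl_nil, I_apply, B_apply]
    rw [← sub_unit, sub_app])

end Counit

end ClosedBraidedOperad

/-! ### The unit and the triangle identities -/

namespace InternalOperad

open BCStructure BraidGroup

/-- The closed braided operad `I_A`. -/
abbrev operad (A : ExtBCAlgebra.{u}) : ClosedBraidedOperad.{u} :=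
  ⟨data A.carrier, isClosedBraidedOperad⟩

variable {A : ExtBCAlgebra.{u}}

/-- Abstraction keeps the underlying element, so nested abstractions can be checked at the arity of
their body. -/
theorem ofElt_eq_abs {n : ℕ} {a : A.carrier} {p : (operad A).Op (n + 1)}
    (h : ofElt (n + 1) a = p) : ofElt n a = (operad A).abs p :=
  ClosedBraidedOperad.abs_unique (P := operad A) ((apply_ofElt_one n a).trans h)

/-- At arity 3 the equations for `B` and `C^±` are the statements that these have arities `2 → 1`
and `2 → 2`. Application is preserved by the formula for `(a b)^•`. -/
theorem isBCHom_ofElt (A : ExtBCAlgebra.{u}) :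
    IsBCHom A.str (operad A).zeroStructure (ofElt (A := A.carrier) 0) where
  map_app a b := val_injective (by
    refine .trans ?_ (val_apply (ofElt 0 a) (ofElt 0 b) rfl).symm
    simp only [val_ofElt, bpow, cmp_I]
    rw [← cmp_assoc, ← cmp_bullet, cmp_assoc]
    exact bullet_of_app a b)
  map_B := ofElt_eq_abs (ofElt_eq_abs (ofElt_eq_abs (val_injective (by
    refine .trans ?_ (val_apply _ _ rfl).symm
    rw [val_one, val_app, I_cmp, val_ofElt]
    exact arity_B.trans (by simp only [bpow, cmp_I])))))
  map_Cpos := ofElt_eq_abs (ofElt_eq_abs (ofElt_eq_abs (val_injective (by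
    refine .trans ?_ (val_act _ _).symm
    rw [val_apply_one, braidElt_σ (by omega), val_app, val_ofElt, crossElt, bpow_one_app]
    exact (arity_C true).trans (by simp only [bpow, cmp_I]; rfl)))))
  map_Cneg := ofElt_eq_abs (ofElt_eq_abs (ofElt_eq_abs (val_injective (by
    refine .trans ?_ (val_act _ _).symm
    rw [val_apply_one, braidElt_σ_inv (by omega), val_app, val_ofElt, bpow_one_app]
    exact (arity_C false).trans (by simp only [bpow, cmp_I]; rfl)))))
  map_I := ofElt_eq_abs (val_injective (by
    rw [val_ofElt, val_one]
    simp only [bpow, cmp_I]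
    exact bullet_I_cmp_B))

theorem up_ofElt (m : ℕ) (a : A.carrier) : (operad A).up m (ofElt 0 a) = ofElt m a := by
  induction m with
  | zero => rfl
  | succ m ih => rw [ClosedBraidedOperad.up, ih]; exact apply_ofElt_one m a

theorem map_ofElt {A' : ExtBCAlgebra.{u}} (h : A ⟶ A') (m : ℕ) (a : A.carrier) :
    InternalOperad.map h m (ofElt m a) = ofElt m (h.toFun a) := by
  refine Subtype.ext ?_
  change h.toFun (bullet a ⊚ bpow m) = bullet (h.toFun a) ⊚ bpow m
  rw [map_cmp, map_bpow]
  simp only [bullet, h.isHom.map_app, h.isHom.map_Cpos, h.isHom.map_I]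

end InternalOperad

open InternalOperad in
/-- The adjunction between the internal operad and the algebra of nullary operators. -/
noncomputable def internalOperadAdjunction :
    internalOperadFunctor.{u} (fun _ => isClosedBraidedOperad) isHom_map ⊣
      zeroFunctor.{u} ClosedBraidedOperad.isExtensionalBC ClosedBraidedOperad.isBCHom_zero where
  unit :=
    { app := fun A => ⟨ofElt 0, isBCHom_ofElt A⟩
      naturality := fun _ _ h => ExtBCAlgebra.Hom.ext (funext fun a => (map_ofElt h 0 a).symm) }
  counit :=
    { app := fun P => ⟨P.counitFun, P.isHom_counitFun⟩
      naturality := fun _ Q φ => ClosedBraidedOperad.Hom.ext (funext fun m => funext fun _ =>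
        ((ClosedBraidedOperad.map_up φ m _).trans (congrArg (Q.up m)
          (((ClosedBraidedOperad.isBCHom_zero φ).map_app _ _).trans
            (congrArg _ (ClosedBraidedOperad.isBCHom_zero φ).map_I)))).symm) }
  -- Since `ofElt 0` is a homomorphism, it commutes with evaluation at `I`; supplying `m` identities
  -- then restores `x = a^• ∘ B^m` from `a^•`.
  left_triangle_components A := ClosedBraidedOperad.Hom.ext (funext fun m => funext fun x =>
    ((congrArg ((operad A).up m) ((congrArg _ (isBCHom_ofElt A).map_I.symm).trans
      ((isBCHom_ofElt A).map_app _ _).symm)).trans (up_ofElt m _)).trans (ofElt_val_app_I x))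
  right_triangle_components P := ExtBCAlgebra.Hom.ext (funext fun a =>
    val_ofElt_app_I (A := P.zero.carrier) 0 a)
/-- The internal operads are closed braided operads, functorially in the algebra; the sets `P(0)`
are extensional `BC^±I`-algebras, functorially in the closed braided operad; and the first functor
is left adjoint to the second. -/
theorem mainTheorem6 :
    ∃ (hI : ∀ A : ExtBCAlgebra.{u}, (InternalOperad.data A.carrier).IsClosedBraidedOperad)
      (hI' : ∀ {A A' : ExtBCAlgebra.{u}} (h : A ⟶ A'),
        OperadData.IsHom (InternalOperad.data A.carrier) (InternalOperad.data A'.carrier)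
          (InternalOperad.map h))
      (hZ : ∀ P : ClosedBraidedOperad.{u}, @IsExtensionalBC (P.Op 0) P.zeroStructure)
      (hZ' : ∀ {P Q : ClosedBraidedOperad.{u}} (φ : P ⟶ Q),
        IsBCHom P.zeroStructure Q.zeroStructure (φ.toFun 0)),
      Nonempty (internalOperadFunctor hI hI' ⊣ zeroFunctor hZ hZ') := by
  exact ⟨fun _ => InternalOperad.isClosedBraidedOperad, InternalOperad.isHom_map,
    ClosedBraidedOperad.isExtensionalBC, ClosedBraidedOperad.isBCHom_zero,
    ⟨internalOperadAdjunction⟩⟩
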